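/- **Setup.** Let $\mathcal X$ be a measurable space, $\mathcal F$ a set of measurable functions $\mathcal X\to\{0,1\}$ and $\mathcal U$ a set of probability distributions on $\mathcal X$. Let $\bar{\mathcal U}$ be the set of mixtures $\int \nu\,d\pi(\nu)$, with $\pi$ a probability measure on $\mathcal U$. * *Covering numbers.* For a distribution $\mu$ and $\epsilon>0$, $\mathrm{NCov}_\mu(\epsilon;\mathcal F)$ is the smallest cardinality of a set $S\subseteq\mathcal F$ with $\inf_{g\in S}\mu(f\ne g)\le\epsilon$ for all $f\in\mathcal F$. * *$\epsilon$-dimension.* $\dim(\epsilon;\mathcal F,\mathcal U)$ is the largest $d$ for which there are a full binary tree of depth $d$, distributions $\mu_v\in\bar{\mathcal U}$ at its non-leaf nodes $v$ and functions $f_e\in\mathcal F$ on its edges $e$ such that (1) for every non-leaf node $v$, the functions $f^l,f^r$ on the two edges from $v$ to its children satisfy $\mu_v(f^l\neq f^r)\ge\epsilon$; (2) if $e=(v_1,v_2)$ and $e'=(v_1',v_2')$ are edges (directed from parent to child) and $v_2'$ is equal to $v_1$ or is an ancestor of $v_1$, then $\mu_{v_1'}(f_e\ne f_{e'})\le\epsilon/3$.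 * *The game.* For a horizon $T\ge1$, an oblivious adversary $\mathcal A$ consists of distributions $\mu_1,\dots,\mu_T\in\mathcal U$ and measurable functions $f_1,\dots,f_T:\mathcal X\to\{0,1\}$. The instances $x_t\sim\mu_t$ are independent, and the labels are $y_t=f_t(x_t)$. A learner $\mathcal L$ predicts $\hat y_t\in\{0,1\}$ as a measurable function of $(x_s)_{s<t}$, $(y_s)_{s<t}$, $x_t$ and of a random seed, which has a fixed law $\rho$ on a measurable space $\Omega$ and is independent of the instances (deterministic learners are the case of a one-point $\Omega$). The oblivious regret is $$\mathrm{Reg}_T(\mathcal L,\mathcal A)=\mathbb E\Big[\sum_{t=1}^T\mathbf 1[\hat y_t\ne y_t]\Big]-\inf_{f\in\mathcal F}\mathbb E\Big[\sum_{t=1}^T\mathbf 1[f(x_t)\neq y_t]\Big].$$ Let $\mathcal R_T=\inf_{\mathcal L}\sup_{\mathcal A}\mathrm{Reg}_T(\mathcal L,\mathcal A)$, and let $\mathcal R_T^\star$ be the same quantity with the supremum restricted to realizable adversaries, those for which some $f\in\mathcal F$ satisfies almost surely $f(x_t)=y_t$ for all $t\le T$. The pair $(\mathcal F,\mathcal U)$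 is obliviously learnable in the agnostic (realizable) setting if $\mathcal R_T/T\to0$ (respectively $\mathcal R^\star_T/T\to0$) as $T\to\infty$. **Statement.** Let $S_{d-1}=\{x\in\mathbb R^d:\|x\|_2=1\}$ and $\mathcal X=\bigsqcup_{d\ge1}S_{d-1}$. For $v\in S_{d-1}$ let $H_v=\{x\in S_{d-1}:v^\top x=0\}$, as a subset of the summand $S_{d-1}$ of $\mathcal X$. Let $$\mathcal F=\{\mathbf 1_{H_v}: d\ge1,\ v\in S_{d-1}\},\qquad \mathcal U=\{\mathrm{Unif}(H_v): d\ge2,\ v\in S_{d-1}\},$$ where $\mathrm{Unif}(H_v)$ is the normalized surface measure of the unit sphere $H_v$ of the Euclidean space $v^\perp$. Then: 1. $\mathcal F$ consists of measurable functions. 2. For every $\epsilon>0$, $\sup_{\mu\in\bar{\mathcal U}}\mathrm{NCov}_\mu(\epsilon;\mathcal F)<\infty$ and $\dim(\epsilon;\mathcal F,\mathcal U)<\infty$. 3. For every probability space $(\Omega,\rho)$ of seeds (in particular for deterministic learners), $\mathcal R_T\ge\mathcal R_T^\star\ge T/4$ for all $T\ge1$. Consequently $(\mathcal F,\mathcal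 U)$ is not obliviously learnable, neither in the realizable nor in the agnostic setting. -/

import Mathlib

open MeasureTheory Set Filter Topology
open scoped ENNReal

noncomputable section

namespace ConstrainedOnline

/-! ### Function classes and distribution classes -/

section Classes

variable {X : Type*} [MeasurableSpace X]

/-- The mixtures of the distribution class `U`: the averages of the members of `U` over an
arbitrary probability measure `π` on `U` (all finite convex combinations are included). -/
def mixtures (U : Set (ProbabilityMeasure X)) : Set (ProbabilityMeasure X) :=
  {μ | ∃ π : Measure U, IsProbabilityMeasure π ∧
    (μ : Measure X) = π.bind fun ν => ((ν : ProbabilityMeasure X) : Measure X)}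

/-- The mass `μ(f ≠ g)` of a disagreement region. -/
def disagreement (μ : ProbabilityMeasure X) (f g : X → Bool) : ℝ≥0∞ :=
  (μ : Measure X) {x | f x ≠ g x}

/-- `S` is an `ε`-covering set of `F` with respect to `μ`. -/
def IsCovering (μ : ProbabilityMeasure X) (ε : ℝ) (F S : Set (X → Bool)) : Prop :=
  S ⊆ F ∧ ∀ f ∈ F, (⨅ g ∈ S, disagreement μ f g) ≤ ENNReal.ofReal ε

/-- The `ε`-covering number of `F` with respect to `μ` (`⊤` if there is no finite covering set). -/
def coveringNumber (μ : ProbabilityMeasure X) (ε : ℝ) (F : Set (X → Bool)) : ℕ∞ :=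
  ⨅ (S : Set (X → Bool)) (_ : IsCovering μ ε F S), S.encard

/-- An interaction tree of depth `d` for `(F, U)`. A node of the full binary tree is the list of
the directions on the path from the root to it, so that the children of `v` are `v ++ [false]` and
`v ++ [true]`, and the non-leaf nodes are the lists of length less than `d`. Such a node `v` is
labelled by the mixture `dist v`, and the edge from `v` to `v ++ [b]` by the function `label v b`.
The values at longer lists are irrelevant. -/
structure InteractionTree (F : Set (X → Bool)) (U : Set (ProbabilityMeasure X)) (d : ℕ) where
  dist : List Bool → ProbabilityMeasure X
  label : List Bool → Bool → X → Bool
  dist_mem : ∀ v, v.length < d → dist v ∈ mixtures U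
  label_mem : ∀ v, v.length < d → ∀ b, label v b ∈ F

/-- The two conditions for the tree to be `ε`-shattered. In the second one, the edge from `w` to
`w ++ [c]` is an ancestor edge of the edge from `v` to `v ++ [b]`: both of its ends lie on the path
from the root to `v`. -/
def InteractionTree.IsShattered {F : Set (X → Bool)} {U : Set (ProbabilityMeasure X)} {d : ℕ}
    (𝒯 : InteractionTree F U d) (ε : ℝ) : Prop :=
  (∀ v, v.length < d →
    ENNReal.ofReal ε ≤ disagreement (𝒯.dist v) (𝒯.label v false) (𝒯.label v true)) ∧
  (∀ v, v.length < d → ∀ b, ∀ w c, w ++ [c] <+: v →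
    disagreement (𝒯.dist w) (𝒯.label v b) (𝒯.label w c) ≤ ENNReal.ofReal (ε / 3))

/-- The `ε`-dimension of `(F, U)`: the maximal depth of an `ε`-shattered tree (`⊤` if there are
such trees of arbitrarily large depth). -/
def epsDim (ε : ℝ) (F : Set (X → Bool)) (U : Set (ProbabilityMeasure X)) : ℕ∞ :=
  ⨆ (d : ℕ) (_ : ∃ 𝒯 : InteractionTree F U d, 𝒯.IsShattered ε), (d : ℕ∞)

end Classes

/-! ### The oblivious online learning game -/

section Game

/-- An oblivious adversary for the distribution class `U` and the horizon `T`. -/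
structure ObliviousAdversary {X : Type*} [MeasurableSpace X] (U : Set (ProbabilityMeasure X))
    (T : ℕ) where
  dist : Fin T → ProbabilityMeasure X
  dist_mem : ∀ t, dist t ∈ U
  value : Fin T → X → Bool
  measurable_value : ∀ t, Measurable (value t)

/-- A learner for the horizon `T` with internal random seed in `Ω`. In round `t` it predicts from
the seed, the past instances, the past labels and the current instance. The deterministic learners
are the case of a one-point space `Ω`. -/
structure Learner (Ω X : Type*) [MeasurableSpace Ω] [MeasurableSpace X] (T : ℕ) where
  predict : (t : Fin T) → Ω × (Fin t → X) × (Fin t → Bool) × X → Bool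
  measurable_predict : ∀ t, Measurable (predict t)

variable {Ω X : Type*} [MeasurableSpace Ω] [MeasurableSpace X]
  {U : Set (ProbabilityMeasure X)} {T : ℕ}

/-- The joint law of the instances: `x_1, …, x_T` are independent with `x_t ∼ μ_t`. -/
def ObliviousAdversary.law (A : ObliviousAdversary U T) : Measure (Fin T → X) :=
  Measure.pi fun t => (A.dist t : Measure X)

/-- The prediction of the learner in round `t` against `A`, on the instances `x`. -/
def Learner.prediction (L : Learner Ω X T) (A : ObliviousAdversary U T) (ω : Ω) (x : Fin T → X)
    (t : Fin T) : Bool :=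
  L.predict t (ω, fun s => x (s.castLE t.is_lt.le),
    fun s => A.value (s.castLE t.is_lt.le) (x (s.castLE t.is_lt.le)), x t)

/-- The expected number of mistakes of the learner, whose seed has the law `ρ`. -/
def learnerLoss (ρ : Measure Ω) (L : Learner Ω X T) (A : ObliviousAdversary U T) : ℝ :=
  ∫ p : Ω × (Fin T → X),
    ∑ t : Fin T, (if L.prediction A p.1 p.2 t ≠ A.value t (p.2 t) then (1 : ℝ) else 0)
    ∂(ρ.prod A.law)

/-- The expected number of mistakes of a fixed function `f`. -/
def functionLoss (f : X → Bool) (A : ObliviousAdversary U T) : ℝ :=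
  ∫ x, ∑ t : Fin T, (if f (x t) ≠ A.value t (x t) then (1 : ℝ) else 0) ∂A.law

/-- The oblivious regret. -/
def obliviousRegret (F : Set (X → Bool)) (ρ : Measure Ω) (L : Learner Ω X T)
    (A : ObliviousAdversary U T) : ℝ :=
  learnerLoss ρ L A - ⨅ f : F, functionLoss (f : X → Bool) A

/-- The adversary is realizable: almost surely, all labels agree with a fixed function of `F`. -/
def ObliviousAdversary.IsRealizable (F : Set (X → Bool)) (A : ObliviousAdversary U T) : Prop :=
  ∃ f ∈ F, ∀ᵐ x ∂A.law, ∀ t, f (x t) = A.value t (x t)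

/-- The agnostic minimax oblivious regret, over the learners with a seed of law `ρ`. -/
def minimaxRegret (ρ : Measure Ω) (F : Set (X → Bool)) (U : Set (ProbabilityMeasure X))
    (T : ℕ) : EReal :=
  ⨅ L : Learner Ω X T, ⨆ A : ObliviousAdversary U T, (obliviousRegret F ρ L A : EReal)

/-- The realizable minimax oblivious regret, over the learners with a seed of law `ρ`. -/
def minimaxRegretRealizable (ρ : Measure Ω) (F : Set (X → Bool)) (U : Set (ProbabilityMeasure X))
    (T : ℕ) : EReal :=
  ⨅ L : Learner Ω X T, ⨆ (A : ObliviousAdversary U T) (_ : A.IsRealizable F),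
    (obliviousRegret F ρ L A : EReal)

/-- Learnability for oblivious adversaries in the agnostic setting. -/
def ObliviouslyLearnable (ρ : Measure Ω) (F : Set (X → Bool))
    (U : Set (ProbabilityMeasure X)) : Prop :=
  Tendsto (fun T : ℕ => minimaxRegret ρ F U T / ((T : ℝ) : EReal)) atTop (𝓝 0)

/-- Learnability for oblivious adversaries in the realizable setting. -/
def ObliviouslyLearnableRealizable (ρ : Measure Ω) (F : Set (X → Bool))
    (U : Set (ProbabilityMeasure X)) : Prop :=
  Tendsto (fun T : ℕ => minimaxRegretRealizable ρ F U T / ((T : ℝ) : EReal)) atTop (𝓝 0)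

end Game

/-! ### The disjoint union of the spheres -/

/-- The unit sphere `S_{d-1}` of `ℝ^d`. -/
abbrev USphere (d : ℕ) : Type := Metric.sphere (0 : EuclideanSpace ℝ (Fin d)) 1

/-- The formal disjoint union of the unit spheres of all `ℝ^d`, `d ≥ 1` (the summand for `d = 0`
is empty). -/
abbrev SphereUnion : Type := Σ d : ℕ, USphere d

/-- The set `X_d ∩ {x : ⟪v, x⟫ = 0}` in the disjoint union. -/
def greatSubsphere {d : ℕ} (v : USphere d) : Set SphereUnion :=
  Sigma.mk d '' {x : USphere d |
    inner ℝ (v : EuclideanSpace ℝ (Fin d)) (x : EuclideanSpace ℝ (Fin d)) = 0}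

open Classical in
/-- The hyperplane indicator `x ↦ 1[x ∈ X_d] 1[⟪v, x⟫ = 0]`. -/
def hyperplaneIndicator {d : ℕ} (v : USphere d) : SphereUnion → Bool :=
  fun x => decide (x ∈ greatSubsphere v)

/-- The class of all hyperplane indicators. -/
def hyperplaneClass : Set (SphereUnion → Bool) :=
  {f | ∃ (d : ℕ) (v : USphere d), f = hyperplaneIndicator v}

/-- The hyperplane of `ℝ^d` orthogonal to `v`. -/
abbrev orthHyperplane {d : ℕ} (v : USphere d) : Submodule ℝ (EuclideanSpace ℝ (Fin d)) :=
  (Submodule.span ℝ {(v : EuclideanSpace ℝ (Fin d))})ᗮ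

/-- The inclusion into the disjoint union of the unit sphere of the hyperplane orthogonal to `v`;
its image is `greatSubsphere v`. -/
def subsphereInclusion {d : ℕ} (v : USphere d)
    (x : Metric.sphere (0 : orthHyperplane v) 1) : SphereUnion :=
  ⟨d, ((x : orthHyperplane v) : EuclideanSpace ℝ (Fin d)), by
    have h : ‖(x : orthHyperplane v)‖ = 1 := mem_sphere_zero_iff_norm.mp x.2
    exact mem_sphere_zero_iff_norm.mpr h⟩

/-- The surface measure of the unit sphere of the hyperplane orthogonal to `v`, which comes from
the Lebesgue measure of this Euclidean space. -/
def subsphereSurface {d : ℕ} (v : USphere d) :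
    Measure (Metric.sphere (0 : orthHyperplane v) 1) :=
  (volume : Measure (orthHyperplane v)).toSphere

/-- The normalized surface measure of the great subsphere orthogonal to `v`. -/
def subsphereMeasure {d : ℕ} (v : USphere d) : Measure SphereUnion :=
  ((subsphereSurface v univ)⁻¹ • subsphereSurface v).map (subsphereInclusion v)

theorem measurable_subsphereInclusion {d : ℕ} (v : USphere d) :
    Measurable (subsphereInclusion v) := by
  have h : Measurable fun y : USphere d => (⟨d, y⟩ : SphereUnion) := by
    rw [measurable_iff_le_map]
    exact iInf_le (fun a => MeasurableSpace.map (Sigma.mk a) (inferInstance :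
      MeasurableSpace (USphere a))) d
  exact h.comp (Measurable.subtype_mk (by fun_prop))

theorem isProbabilityMeasure_subsphereMeasure {d : ℕ} (hd : 2 ≤ d) (v : USphere d) :
    IsProbabilityMeasure (subsphereMeasure v) := by
  have hv : (v : EuclideanSpace ℝ (Fin d)) ≠ 0 := by
    intro h
    have := v.2
    simp [h] at this
  have hfin : Module.finrank ℝ (orthHyperplane v) = d - 1 := by
    have h1 := (Submodule.span ℝ {(v : EuclideanSpace ℝ (Fin d))}).finrank_add_finrank_orthogonal
    rw [finrank_span_singleton hv, finrank_euclideanSpace_fin] at h1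
    exact Nat.eq_sub_of_add_eq' h1
  have : Nontrivial (orthHyperplane v) :=
    Module.nontrivial_of_finrank_pos (R := ℝ) (by omega)
  have h0 : subsphereSurface v univ ≠ 0 := by
    rw [Ne, Measure.measure_univ_eq_zero]
    exact Measure.toSphere_ne_zero _
  have ht : subsphereSurface v univ ≠ ⊤ := by
    unfold subsphereSurface
    exact measure_ne_top _ _
  constructor
  rw [subsphereMeasure, Measure.map_apply (measurable_subsphereInclusion v) MeasurableSet.univ]
  simp [ENNReal.inv_mul_cancel h0 ht]

/-- The uniform distribution on the great subsphere `X_d ∩ {x : ⟪v, x⟫ = 0}`, for `d ≥ 2` (for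
`d = 1` this set is empty). -/
def subsphereUniform {d : ℕ} (hd : 2 ≤ d) (v : USphere d) : ProbabilityMeasure SphereUnion :=
  ⟨subsphereMeasure v, isProbabilityMeasure_subsphereMeasure hd v⟩

/-- The class of the uniform distributions on all great subspheres. -/
def subsphereClass : Set (ProbabilityMeasure SphereUnion) :=
  {μ | ∃ (d : ℕ) (hd : 2 ≤ d) (v : USphere d), μ = subsphereUniform hd v}

end ConstrainedOnline

end

open ConstrainedOnline

noncomputable section

namespace ConstrainedOnline

/-! ### The Gaussian measure with density `exp (-π ‖x‖ ^ 2)` -/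

section Gaussian

variable (E : Type*) [NormedAddCommGroup E] [InnerProductSpace ℝ E] [FiniteDimensional ℝ E]
  [MeasurableSpace E] [BorelSpace E]

/-! The capacity bounds are soft. Under each `Unif(H_u)`, a great subsphere other than `H_u` is a
null set, so under every mixture two distinct functions of the class are almost surely not both 1.
At most `1 / ε` of them have mass at least `ε`, and these together with the zero function form an
`ε`-cover. In a shattered tree, a label of mass at least `ε / 2` at the root must be repeated on
both edges below it, so the dimension is at most 1.

For the regret, take two independent Gaussian vectors `v`, `w` in dimension `d = 8 T ^ 2 + 2 T` and
fair bits `b`. In round `t` the instance is uniform on `H_v` with label 1 if `b t` holds, and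
uniform on `H_w` with label 0 otherwise. The function `1_{H_v}` realizes these labels. When `v` and
`w` are averaged out, the law of the instances dominates `9/16` times a product law `Q ^ T` that
does not depend on `b`, and under `Q ^ T` every learner errs with probability `1/2` per round. Hence
the average loss is at least `9 T / 32 ≥ T / 4`, and some fixed `v`, `w`, `b` does as badly
(`exists_realizable_obliviousRegret_ge`).

The heart is the domination, `le_lintegral_reject`. The uniform law on `H_v` is the law of the
direction of the component of a Gaussian vector orthogonal to `v`, so it suffices to treat `k`
independent Gaussian vectors in the hyperplane orthogonal to a Gaussian `v`. For one such vector
`x`, the pair `(v, x)` has a law on orthogonal pairs which becomes symmetric after weighting by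
`‖x‖` (`lintegral_reject_symm`). So one may draw `x` first, at the price of a factor `‖x‖⁻¹ ‖v‖`,
and then `v` in the hyperplane orthogonal to `x`. Iterating replaces the mixture by a product with
weights `‖x_i‖⁻¹` times a moment of `‖v‖` in the remaining dimension. Jensen for that moment and
Hölder for the normalization of `‖x‖⁻¹` leave the constant `(r / (r + 2 T)) ^ T` with `r = 8 T ^ 2`,
which is at least `3/4`. One such factor is paid for each of `v` and `w`. -/

/-- The Gaussian density `exp (-π ‖x‖ ^ 2)`. -/
def gaussDensity {E : Type*} [NormedAddCommGroup E] (x : E) : ℝ≥0∞ :=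
  ENNReal.ofReal (Real.exp (-Real.pi * ‖x‖ ^ 2))

/-- The rotation invariant Gaussian measure with density `exp (-π ‖x‖ ^ 2)`. -/
def gauss : Measure E := (volume : Measure E).withDensity gaussDensity

@[fun_prop]
theorem measurable_gaussDensity (E : Type*) [NormedAddCommGroup E] [MeasurableSpace E]
    [BorelSpace E] : Measurable (gaussDensity : E → ℝ≥0∞) := by
  unfold gaussDensity
  fun_prop

variable {E}

theorem lintegral_gauss (f : E → ℝ≥0∞) :
    ∫⁻ x, f x ∂gauss E = ∫⁻ x, gaussDensity x * f x := by
  rw [gauss, lintegral_withDensity_eq_lintegral_mul_non_measurable _ (measurable_gaussDensity E)]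
  · rfl
  · exact Eventually.of_forall fun x => ENNReal.ofReal_lt_top

theorem gauss_absolutelyContinuous : gauss E ≪ volume :=
  withDensity_absolutelyContinuous _ _

theorem gaussDensity_add {E : Type*} [NormedAddCommGroup E] [InnerProductSpace ℝ E] {x y : E}
    (h : inner ℝ x y = 0) : gaussDensity (x + y) = gaussDensity x * gaussDensity y := by
  unfold gaussDensity
  rw [← ENNReal.ofReal_mul (Real.exp_pos _).le, ← Real.exp_add, sq ‖x + y‖,
    norm_add_sq_eq_norm_sq_add_norm_sq_of_inner_eq_zero x y h]
  ring_nf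

instance : IsProbabilityMeasure (gauss E) := by
  constructor
  have h := GaussianFourier.integral_rexp_neg_mul_sq_norm (V := E) Real.pi_pos
  rw [div_self Real.pi_ne_zero, Real.one_rpow] at h
  rw [gauss, withDensity_apply _ MeasurableSet.univ, Measure.restrict_univ]
  unfold gaussDensity
  rw [← ofReal_integral_eq_lintegral_ofReal, h, ENNReal.ofReal_one]
  · by_contra hn
    rw [integral_undef hn] at h
    exact zero_ne_one h
  · exact Eventually.of_forall fun x => (Real.exp_pos _).le

theorem measurePreserving_smul_add {e : E} (he : ‖e‖ = 1) :
    MeasurePreserving (fun p : ℝ × (ℝ ∙ e)ᗮ => p.1 • e + (p.2 : E))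
      (volume.prod volume) volume := by
  have h1 := ((LinearIsometryEquiv.toSpanUnitSingleton (𝕜 := ℝ) e he).measurePreserving).prod
    (MeasurePreserving.id (volume : Measure (ℝ ∙ e)ᗮ))
  have h2 := (WithLp.volume_preserving_toLp (ℝ ∙ e) (ℝ ∙ e)ᗮ)
  have h3 := (ℝ ∙ e).orthogonalDecomposition.symm.measurePreserving
  have h : (fun p : ℝ × (ℝ ∙ e)ᗮ => p.1 • e + (p.2 : E)) =
      (ℝ ∙ e).orthogonalDecomposition.symm ∘ WithLp.toLp 2 ∘
        Prod.map (LinearIsometryEquiv.toSpanUnitSingleton (𝕜 := ℝ) e he) id := by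
    ext p
    simp
  rw [h]
  exact h3.comp (h2.comp h1)

theorem measurePreserving_gauss_smul_add {e : E} (he : ‖e‖ = 1) :
    MeasurePreserving (fun p : ℝ × (ℝ ∙ e)ᗮ => p.1 • e + (p.2 : E))
      ((gauss ℝ).prod (gauss (ℝ ∙ e)ᗮ)) (gauss E) := by
  have hm : Measurable (fun p : ℝ × (ℝ ∙ e)ᗮ => p.1 • e + (p.2 : E)) := by fun_prop
  refine ⟨hm, ?_⟩
  ext s hs
  rw [Measure.map_apply hm hs, gauss, gauss, prod_withDensity (by fun_prop) (by fun_prop), gauss,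
    withDensity_apply _ (hm hs), withDensity_apply _ hs,
    ← (measurePreserving_smul_add he).setLIntegral_comp_preimage hs (measurable_gaussDensity E)]
  refine lintegral_congr fun p => ?_
  rw [gaussDensity_add]
  · simp [gaussDensity, norm_smul, he]
  · rw [inner_smul_left, Submodule.mem_orthogonal_singleton_iff_inner_right.1 p.2.2, mul_zero]

end Gaussian

/-! ### Orthogonal components of Gaussian vectors -/

section Reject

variable {E : Type*} [NormedAddCommGroup E] [InnerProductSpace ℝ E]

/-- The component of `g` orthogonal to `v`. -/
def reject (v g : E) : E := g - (inner ℝ v g / ‖v‖ ^ 2) • v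

theorem inner_reject (v g : E) : inner ℝ v (reject v g) = 0 := by
  by_cases hv : v = 0
  · simp [hv]
  · have : ‖v‖ ≠ 0 := norm_ne_zero_iff.2 hv
    rw [reject, inner_sub_right, inner_smul_right, real_inner_self_eq_norm_sq]
    field_simp
    ring

theorem reject_of_inner_eq_zero {v g : E} (h : inner ℝ v g = 0) : reject v g = g := by
  simp [reject, h]

theorem reject_add (v g h : E) : reject v (g + h) = reject v g + reject v h := by
  simp only [reject, inner_add_right, add_div, add_smul]
  abel

theorem reject_smul (v : E) (t : ℝ) (g : E) : reject v (t • g) = t • reject v g := by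
  simp only [reject, inner_smul_right, smul_sub, smul_smul, mul_div_assoc]

theorem reject_self (v : E) : reject v v = 0 := by
  by_cases hv : v = 0
  · simp [hv, reject]
  · have : ‖v‖ ≠ 0 := norm_ne_zero_iff.2 hv
    rw [reject, real_inner_self_eq_norm_sq, div_self (by positivity), one_smul, sub_self]

theorem reject_smul_left {t : ℝ} (ht : t ≠ 0) (v g : E) : reject (t • v) g = reject v g := by
  by_cases hv : v = 0
  · simp [hv]
  · have : ‖v‖ ≠ 0 := norm_ne_zero_iff.2 hv
    rw [reject, reject, smul_smul, inner_smul_left, norm_smul, mul_pow, Real.norm_eq_abs, sq_abs]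
    congr 2
    simp only [conj_trivial]
    field_simp

variable [FiniteDimensional ℝ E] [MeasurableSpace E] [BorelSpace E]

@[fun_prop]
theorem measurable_reject {α : Type*} [MeasurableSpace α] {f g : α → E} (hf : Measurable f)
    (hg : Measurable g) : Measurable fun a => reject (f a) (g a) := by
  unfold reject
  fun_prop

/-- The law of the component orthogonal to `v` of a Gaussian vector, in the coordinates of the
hyperplane orthogonal to a unit vector `e`. -/
theorem lintegral_reject {e v : E} (he : ‖e‖ = 1) (hv : inner ℝ e v ≠ 0)
    {φ : E → ℝ≥0∞} (hφ : Measurable φ) :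
    ∫⁻ g, φ (reject v g) ∂gauss E = ENNReal.ofReal (‖v‖ * |inner ℝ e v|⁻¹) *
      ∫⁻ y : (ℝ ∙ e)ᗮ, gaussDensity ((y : E) - (inner ℝ v (y : E) / inner ℝ e v) • e) *
        φ ((y : E) - (inner ℝ v (y : E) / inner ℝ e v) • e) := by
  have hv0 : v ≠ 0 := by rintro rfl; simp at hv
  have hvn : ‖v‖ ≠ 0 := norm_ne_zero_iff.2 hv0
  set a : ℝ := inner ℝ e v with ha
  have hey : ∀ y : (ℝ ∙ e)ᗮ, inner ℝ e (y : E) = 0 := fun y =>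
    Submodule.mem_orthogonal_singleton_iff_inner_right.1 y.2
  have hva : inner ℝ v e = a := by rw [real_inner_comm]
  -- The hyperplane orthogonal to `v` as a graph over the one orthogonal to `e`.
  set x : (ℝ ∙ e)ᗮ → E := fun y => (y : E) - (inner ℝ v (y : E) / a) • e with hx
  set ψ : E → ℝ≥0∞ := fun z => gaussDensity z * φ z with hψ
  have hψm : Measurable ψ := by fun_prop
  have hsplit : ∀ g : E, gaussDensity g * φ (reject v g) =
      gaussDensity (inner ℝ v g / ‖v‖) * ψ (reject v g) := by
    intro g
    have : g = (inner ℝ v g / ‖v‖ ^ 2) • v + reject v g := by simp [reject]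
    have h2 : gaussDensity ((inner ℝ v g / ‖v‖ ^ 2) • v) = gaussDensity (inner ℝ v g / ‖v‖) := by
      unfold gaussDensity
      congr 4
      rw [norm_smul, Real.norm_eq_abs, Real.norm_eq_abs, abs_div, abs_div, abs_norm, abs_pow,
        abs_norm]
      field_simp
    conv_lhs => rw [this]
    rw [gaussDensity_add, h2, hψ, mul_assoc, reject_add, reject_smul, reject_self, smul_zero,
      zero_add, reject_of_inner_eq_zero (inner_reject v g)]
    rw [inner_smul_left, inner_reject, mul_zero]
  have hxv : ∀ y, inner ℝ v (x y) = 0 := by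
    intro y
    simp only [hx]
    rw [inner_sub_right, inner_smul_right, hva]
    field_simp
    ring
  rw [lintegral_gauss]
  simp_rw [hsplit]
  rw [← (measurePreserving_smul_add he).lintegral_comp (by fun_prop)]
  rw [lintegral_prod_symm _ (by fun_prop)]
  -- The vector over which the graph passes through `reject v e`: adding `t • e` to a point before
  -- projecting amounts to translating its base point by `t • k`.
  set k : (ℝ ∙ e)ᗮ := ⟨reject v e - inner ℝ e (reject v e) • e, by
    rw [Submodule.mem_orthogonal_singleton_iff_inner_right, inner_sub_right, inner_smul_right,
      real_inner_self_eq_norm_sq, he]; ring⟩ with hk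
  have hxk : x k = reject v e := by
    have h1 : inner ℝ v (k : E) = - inner ℝ e (reject v e) * a := by
      simp only [hk]
      rw [inner_sub_right, inner_reject, inner_smul_right, hva]; ring
    simp only [hx]
    rw [h1, mul_div_assoc, div_self hv, mul_one, neg_smul, sub_neg_eq_add]
    simp [hk]
  have hxadd : ∀ (y z : (ℝ ∙ e)ᗮ) (t : ℝ), x (y + t • z) = x y + t • x z := by
    intro y z t
    simp only [hx]
    push_cast
    rw [inner_add_right, inner_smul_right, add_div, add_smul, smul_sub, smul_smul, mul_div_assoc]
    abel
  calc ∫⁻ y : (ℝ ∙ e)ᗮ, ∫⁻ t : ℝ, gaussDensity (inner ℝ v (t • e + (y : E)) / ‖v‖) *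
          ψ (reject v (t • e + (y : E)))
      = ∫⁻ y : (ℝ ∙ e)ᗮ, ∫⁻ t : ℝ, gaussDensity (t * (a / ‖v‖)) * ψ (x (y + t • k)) := by
        refine lintegral_congr fun y => ?_
        -- For fixed `y`, this shift of the origin of `t` makes `t = 0` correspond to the point `x
        -- y` of the graph.
        rw [← lintegral_sub_right_eq_self _ (inner ℝ v (y : E) / a)]
        refine lintegral_congr fun t => ?_
        have h1 : (t - inner ℝ v (y : E) / a) • e + (y : E) = x y + t • e := by
          simp only [hx, sub_smul]; abel
        rw [h1, reject_add, reject_of_inner_eq_zero (hxv y), reject_smul, hxadd, hxk,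
          inner_add_right, hxv, inner_smul_right, hva, zero_add, mul_div_assoc]
    _ = ∫⁻ t : ℝ, ∫⁻ y : (ℝ ∙ e)ᗮ, gaussDensity (t * (a / ‖v‖)) * ψ (x (y + t • k)) := by
        refine lintegral_lintegral_swap (Measurable.aemeasurable ?_)
        simp only [Function.uncurry_def, hx]
        fun_prop
    _ = ∫⁻ t : ℝ, gaussDensity (t * (a / ‖v‖)) * ∫⁻ y : (ℝ ∙ e)ᗮ, ψ (x y) := by
        refine lintegral_congr fun t => ?_
        rw [lintegral_const_mul _ (by simp only [hx]; fun_prop)]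
        -- Translation invariance in `y` decouples the two integrals; the remaining one over `t`
        -- yields the Jacobian `‖v‖ / |a|`.
        rw [lintegral_add_right_eq_self (fun y => ψ (x y)) (t • k)]
    _ = _ := by
        rw [lintegral_mul_const _ (by fun_prop)]
        congr 1
        have hc : a / ‖v‖ ≠ 0 := div_ne_zero hv hvn
        have h1 : ∫⁻ t : ℝ, gaussDensity (t * (a / ‖v‖)) =
            ∫⁻ t : ℝ, gaussDensity t ∂(Measure.map (fun t => t * (a / ‖v‖)) volume) := by
          rw [lintegral_map (by fun_prop) (by fun_prop)]
        have h2 : ∫⁻ t : ℝ, gaussDensity t = 1 := by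
          have := lintegral_gauss (E := ℝ) 1
          simpa using this.symm
        rw [h1, Real.map_volume_mul_right hc, lintegral_smul_measure, h2, smul_eq_mul, mul_one]
        congr 1
        rw [inv_div, abs_div, abs_norm]
        rfl

/-- The measure `ds / |s|` is invariant under the substitution `s ↦ c / s`, which swaps the two
entries of `(s, c / s)`. -/
theorem lintegral_inversion {c : ℝ} (hc : c ≠ 0) {f : ℝ × ℝ → ℝ≥0∞} :
    ∫⁻ s : ℝ, ENNReal.ofReal |s|⁻¹ * f (s, c / s) =
      ∫⁻ s : ℝ, ENNReal.ofReal |s|⁻¹ * f (c / s, s) := by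
  have h0 : ∀ g : ℝ → ℝ≥0∞, ∫⁻ s, g s = ∫⁻ s in ({0} : Set ℝ)ᶜ, g s := fun g => by
    rw [restrict_compl_singleton]
  have himg : (fun s => c / s) '' ({0} : Set ℝ)ᶜ = ({0} : Set ℝ)ᶜ := by
    ext s
    simp only [mem_image, mem_compl_iff, mem_singleton_iff]
    constructor
    · rintro ⟨u, hu, rfl⟩
      exact div_ne_zero hc hu
    · intro hs
      exact ⟨c / s, div_ne_zero hc hs, by field_simp⟩
  rw [h0 (fun s => ENNReal.ofReal |s|⁻¹ * f (c / s, s)), h0]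
  conv_rhs => rw [← himg]
  rw [lintegral_image_eq_lintegral_abs_deriv_mul (f' := fun s => -c / s ^ 2)
    (measurableSet_singleton _).compl]
  · refine setLIntegral_congr_fun (measurableSet_singleton _).compl fun s hs => ?_
    have hs : s ≠ 0 := hs
    rw [← mul_assoc, ← ENNReal.ofReal_mul (abs_nonneg _)]
    congr 2
    · rw [abs_div, abs_div, abs_neg, abs_pow]
      have : |c| ≠ 0 := abs_ne_zero.2 hc
      have : |s| ≠ 0 := abs_ne_zero.2 hs
      field_simp
    · rw [div_div_cancel₀ hc]
  · intro s hs
    have h : HasDerivAt (fun s => c / s) (-c / s ^ 2) s := by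
      simpa [div_eq_mul_inv] using (hasDerivAt_inv (x := s) hs).const_mul c
    exact h.hasDerivWithinAt
  · intro s hs t ht h
    have hs : s ≠ 0 := hs
    have ht : t ≠ 0 := ht
    simp only at h
    field_simp at h
    exact h.symm

end Reject

/-! ### Exchange symmetry of orthogonal pairs -/

section Incidence

variable {E : Type*} [NormedAddCommGroup E] [InnerProductSpace ℝ E]
  [FiniteDimensional ℝ E] [MeasurableSpace E] [BorelSpace E]

theorem ae_inner_ne_zero {v : E} (hv : v ≠ 0) : ∀ᵐ y : E, inner ℝ v y ≠ 0 := by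
  have h : (ℝ ∙ v)ᗮ ≠ ⊤ := by
    intro h
    have : v ∈ (ℝ ∙ v)ᗮ := h ▸ Submodule.mem_top
    rw [Submodule.mem_orthogonal_singleton_iff_inner_right, inner_self_eq_zero] at this
    exact hv this
  have h0 := Measure.addHaar_submodule (volume : Measure E) _ h
  rw [ae_iff]
  convert h0 using 2
  ext y
  simp [Submodule.mem_orthogonal_singleton_iff_inner_right]

theorem ae_ne_zero [Nontrivial E] : ∀ᵐ y : E, y ≠ 0 := by
  rw [ae_iff]
  simp

/-- The joint law of a Gaussian vector and of the component orthogonal to it of another one, in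
the coordinates along and orthogonal to a unit vector `e`. -/
theorem lintegral_lintegral_reject {e : E} (he : ‖e‖ = 1) {H : E × E → ℝ≥0∞}
    (hH : Measurable H) :
    ∫⁻ v, ∫⁻ g, H (v, reject v g) ∂gauss E ∂gauss E =
      ∫⁻ v : (ℝ ∙ e)ᗮ, ∫⁻ y : (ℝ ∙ e)ᗮ, ∫⁻ s : ℝ, ENNReal.ofReal |s|⁻¹ *
        (gaussDensity (s • e + (v : E)) *
          gaussDensity (((-inner ℝ (v : E) (y : E)) / s) • e + (y : E)) *
          ‖s • e + (v : E)‖ₑ *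
          H (s • e + (v : E), ((-inner ℝ (v : E) (y : E)) / s) • e + (y : E))) := by
  have hey : ∀ y : (ℝ ∙ e)ᗮ, inner ℝ e (y : E) = 0 := fun y =>
    Submodule.mem_orthogonal_singleton_iff_inner_right.1 y.2
  have hm : Measurable fun v => ∫⁻ g, H (v, reject v g) ∂gauss E := by
    refine Measurable.lintegral_prod_right' (f := fun p : E × E => H (p.1, reject p.1 p.2)) ?_
    fun_prop
  rw [lintegral_gauss, ← (measurePreserving_smul_add he).lintegral_comp (by fun_prop),
    lintegral_prod_symm _ (by fun_prop)]
  refine lintegral_congr fun v => ?_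
  rw [lintegral_lintegral_swap (Measurable.aemeasurable (by
    simp only [Function.uncurry_def]; fun_prop))]
  refine lintegral_congr_ae ?_
  filter_upwards [ae_ne_zero (E := ℝ)] with s hs
  have h1 : inner ℝ e (s • e + (v : E)) = s := by
    rw [inner_add_right, inner_smul_right, real_inner_self_eq_norm_sq, he, hey]; ring
  have h2 : ∀ y : (ℝ ∙ e)ᗮ, (y : E) - (inner ℝ (s • e + (v : E)) (y : E) / s) • e =
      ((-inner ℝ (v : E) (y : E)) / s) • e + (y : E) := by
    intro y
    rw [inner_add_left, inner_smul_left, hey, mul_zero, zero_add, neg_div, neg_smul]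
    abel
  rw [lintegral_reject he (by rwa [h1]) (φ := fun x => H (s • e + (v : E), x)) (by fun_prop)]
  simp only [h1, h2]
  rw [lintegral_const_mul _ (by fun_prop), ENNReal.ofReal_mul (norm_nonneg _), ofReal_norm]
  rw [← lintegral_const_mul _ (by fun_prop), ← lintegral_const_mul _ (by fun_prop),
    ← lintegral_const_mul _ (by fun_prop)]
  refine lintegral_congr fun y => ?_
  ring

/-- The law of an orthogonal pair is symmetric, up to the norms as weights. -/
theorem lintegral_reject_symm (hE : 2 ≤ Module.finrank ℝ E) {G : E × E → ℝ≥0∞}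
    (hG : Measurable G) :
    ∫⁻ v, ∫⁻ g, ‖reject v g‖ₑ * G (v, reject v g) ∂gauss E ∂gauss E =
      ∫⁻ x, ∫⁻ h, ‖reject x h‖ₑ * G (reject x h, x) ∂gauss E ∂gauss E := by
  have : Nontrivial E := Module.nontrivial_of_finrank_pos (R := ℝ) (by omega)
  obtain ⟨e, he⟩ := exists_norm_eq E zero_le_one
  have : Nontrivial (ℝ ∙ e)ᗮ := by
    refine Module.nontrivial_of_finrank_pos (R := ℝ) ?_
    have he0 : e ≠ 0 := by rintro rfl; simp at he
    have h1 := (ℝ ∙ e).finrank_add_finrank_orthogonal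
    rw [finrank_span_singleton he0] at h1
    omega
  -- In these coordinates the weight `‖x‖` of the second vector complements the factor `‖v‖` already
  -- in the density. All factors are then symmetric, except that the coordinates along `e` are `s`
  -- and `c / s` on one side and swapped on the other.
  have hL := lintegral_lintegral_reject he (H := fun p => ‖p.2‖ₑ * G p) (by fun_prop)
  have hR := lintegral_lintegral_reject he (H := fun p => ‖p.2‖ₑ * G (p.2, p.1)) (by fun_prop)
  dsimp only at hL hR
  rw [hL, hR]
  have hmeas : ∀ f : E × E → ℝ≥0∞, Measurable f → Measurable
      (Function.uncurry fun (v y : (ℝ ∙ e)ᗮ) => ∫⁻ s : ℝ, ENNReal.ofReal |s|⁻¹ *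
        f (s • e + (v : E), ((-inner ℝ (v : E) (y : E)) / s) • e + (y : E))) := by
    intro f hf
    refine Measurable.lintegral_prod_right' (f := fun p : ((ℝ ∙ e)ᗮ × (ℝ ∙ e)ᗮ) × ℝ =>
      ENNReal.ofReal |p.2|⁻¹ * f (p.2 • e + (p.1.1 : E),
        ((-inner ℝ (p.1.1 : E) (p.1.2 : E)) / p.2) • e + (p.1.2 : E))) ?_
    fun_prop
  rw [lintegral_lintegral_swap (hmeas (fun p => gaussDensity p.1 * gaussDensity p.2 * ‖p.1‖ₑ *
    (‖p.2‖ₑ * G p)) (by fun_prop)).aemeasurable]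
  refine lintegral_congr_ae ?_
  filter_upwards [ae_ne_zero (E := (ℝ ∙ e)ᗮ)] with y hy
  refine lintegral_congr_ae ?_
  filter_upwards [ae_inner_ne_zero hy] with v hv
  -- The product of the two coordinates along `e` is this constant; for almost all pairs it is
  -- nonzero, as the inversion requires.
  have hv' : -inner ℝ (v : E) (y : E) ≠ 0 := by
    rw [real_inner_comm]
    exact neg_ne_zero.2 hv
  have := lintegral_inversion hv' (f := fun q => gaussDensity (q.1 • e + (v : E)) *
    gaussDensity (q.2 • e + (y : E)) * ‖q.1 • e + (v : E)‖ₑ * (‖q.2 • e + (y : E)‖ₑ *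
      G (q.1 • e + (v : E), q.2 • e + (y : E))))
  rw [this]
  refine lintegral_congr fun s => ?_
  rw [real_inner_comm (y : E) (v : E)]
  ring

end Incidence

/-! ### Moments of the norm of a Gaussian vector -/

section Moments

/-- The second moment of the one-dimensional Gaussian measure. -/
def gaussSecondMoment : ℝ≥0∞ := ∫⁻ t, ‖t‖ₑ ^ 2 ∂gauss ℝ

theorem gaussSecondMoment_ne_zero : gaussSecondMoment ≠ 0 := by
  intro h
  rw [gaussSecondMoment, lintegral_gauss, lintegral_eq_zero_iff (by fun_prop)] at h
  obtain ⟨t, ht, ht0⟩ := (h.and (ae_ne_zero (E := ℝ))).exists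
  simp only [Pi.zero_apply, mul_eq_zero, gaussDensity, ENNReal.ofReal_eq_zero] at ht
  rcases ht with ht | ht
  · exact absurd ht (not_le.2 (Real.exp_pos _))
  · simp [ht0] at ht

theorem gaussSecondMoment_ne_top : gaussSecondMoment ≠ ⊤ := by
  have h : Integrable (fun t : ℝ => t ^ 2 * Real.exp (-Real.pi * t ^ 2)) := by
    simpa using integrable_rpow_mul_exp_neg_mul_sq Real.pi_pos (s := 2) (by norm_num)
  rw [gaussSecondMoment, lintegral_gauss]
  refine ne_of_lt (lt_of_le_of_lt (lintegral_mono fun t => ?_) h.2)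
  simp only [gaussDensity]
  rw [← ofReal_norm, ← ofReal_norm, ← ENNReal.ofReal_pow (norm_nonneg _),
    ← ENNReal.ofReal_mul (Real.exp_pos _).le]
  refine ENNReal.ofReal_le_ofReal (le_of_eq ?_)
  rw [norm_mul, norm_pow, Real.norm_of_nonneg (Real.exp_pos _).le, Real.norm_eq_abs, sq_abs]
  ring

theorem lintegral_enorm_sq_gauss (n : ℕ) : ∀ (E : Type*) [NormedAddCommGroup E]
    [InnerProductSpace ℝ E] [FiniteDimensional ℝ E] [MeasurableSpace E] [BorelSpace E],
    Module.finrank ℝ E = n → ∫⁻ x : E, ‖x‖ₑ ^ 2 ∂gauss E = n * gaussSecondMoment := by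
  induction n with
  | zero =>
    intro E _ _ _ _ _ h
    have : Subsingleton E := Module.finrank_zero_iff.1 h
    have h0 : ∀ x : E, ‖x‖ₑ ^ 2 = 0 := fun x => by simp [Subsingleton.elim x 0]
    simp [h0]
  | succ n ih =>
    intro E _ _ _ _ _ h
    have : Nontrivial E := Module.nontrivial_of_finrank_pos (R := ℝ) (by omega)
    obtain ⟨e, he⟩ := exists_norm_eq E zero_le_one
    have he0 : e ≠ 0 := by rintro rfl; simp at he
    have h1 := (ℝ ∙ e).finrank_add_finrank_orthogonal
    rw [finrank_span_singleton he0] at h1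
    have h2 := ih (ℝ ∙ e)ᗮ (by omega)
    rw [← (measurePreserving_gauss_smul_add he).lintegral_comp (by fun_prop)]
    have h3 : ∀ p : ℝ × (ℝ ∙ e)ᗮ, ‖p.1 • e + (p.2 : E)‖ₑ ^ 2 = ‖p.1‖ₑ ^ 2 + ‖p.2‖ₑ ^ 2 := by
      intro p
      have hin : inner ℝ (p.1 • e) (p.2 : E) = 0 := by
        rw [inner_smul_left, Submodule.mem_orthogonal_singleton_iff_inner_right.1 p.2.2, mul_zero]
      rw [← ofReal_norm, ← ofReal_norm, ← ofReal_norm, ← ENNReal.ofReal_pow (norm_nonneg _),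
        ← ENNReal.ofReal_pow (norm_nonneg _), ← ENNReal.ofReal_pow (norm_nonneg _),
        ← ENNReal.ofReal_add (by positivity) (by positivity), sq ‖_ + _‖,
        norm_add_sq_eq_norm_sq_add_norm_sq_of_inner_eq_zero _ _ hin, norm_smul, he]
      simp [sq]
    simp_rw [h3]
    rw [lintegral_prod _ (by fun_prop)]
    simp_rw [lintegral_add_left measurable_const, lintegral_const, measure_univ, mul_one]
    rw [lintegral_add_right _ measurable_const, lintegral_const, measure_univ, mul_one, h2,
      ← gaussSecondMoment]
    push_cast
    ring

variable {E : Type*} [NormedAddCommGroup E] [InnerProductSpace ℝ E] [FiniteDimensional ℝ E]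
  [MeasurableSpace E] [BorelSpace E]

/-- Jensen's inequality, in the form that the `L^2` norm is at most the `L^(2m)` norm for a
probability measure. -/
theorem pow_le_lintegral_enorm_pow_gauss {m : ℕ} (hm : 1 ≤ m) :
    (Module.finrank ℝ E * gaussSecondMoment) ^ m ≤ ∫⁻ x : E, ‖x‖ₑ ^ (2 * m) ∂gauss E := by
  rw [← lintegral_enorm_sq_gauss _ E rfl]
  have h := eLpNorm_le_eLpNorm_of_exponent_le (μ := gauss E) (f := fun x : E => x)
    (p := 2) (q := ((2 * m : ℕ) : ℝ≥0∞)) (by exact_mod_cast (by omega : 2 ≤ 2 * m))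
    (by fun_prop)
  rw [eLpNorm_eq_lintegral_rpow_enorm_toReal (by norm_num) (by norm_num),
    eLpNorm_eq_lintegral_rpow_enorm_toReal (by simp; omega) (ENNReal.natCast_ne_top _)] at h
  simp only [ENNReal.toReal_natCast, ENNReal.toReal_ofNat, ENNReal.rpow_natCast,
    ENNReal.rpow_ofNat] at h
  have h2 := ENNReal.rpow_le_rpow h (z := ((2 * m : ℕ) : ℝ)) (by positivity)
  rw [← ENNReal.rpow_mul, ← ENNReal.rpow_mul] at h2
  have hm0 : (m : ℝ) ≠ 0 := by positivity
  have e1 : 1 / 2 * ((2 * m : ℕ) : ℝ) = m := by push_cast; field_simp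
  have e2 : 1 / ((2 * m : ℕ) : ℝ) * ((2 * m : ℕ) : ℝ) = 1 := by push_cast; field_simp
  rwa [e1, e2, ENNReal.rpow_natCast, ENNReal.rpow_one] at h2

/-- Hölder with exponents `3` and `3/2` for `1 = ‖x‖ ^ (2/3) * ‖x‖⁻¹ ^ (2/3)`, raised to the third
power. It bounds below the normalizing constant of the density `‖x‖⁻¹`. -/
theorem one_le_lintegral_inv_enorm_gauss [Nontrivial E] :
    1 ≤ (∫⁻ x : E, ‖x‖ₑ⁻¹ ∂gauss E) ^ 2 * (Module.finrank ℝ E * gaussSecondMoment) := by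
  rw [← lintegral_enorm_sq_gauss _ E rfl]
  have hpq : (3 : ℝ).HolderConjugate (3 / 2) := by
    rw [Real.holderConjugate_iff]; norm_num
  have h := ENNReal.lintegral_mul_le_Lp_mul_Lq (gauss E) hpq
    (f := fun x : E => ‖x‖ₑ ^ (2 / 3 : ℝ)) (g := fun x : E => ‖x‖ₑ⁻¹ ^ (2 / 3 : ℝ))
    (by fun_prop) (by fun_prop)
  have h1 : ∫⁻ x : E, ((fun x : E => ‖x‖ₑ ^ (2 / 3 : ℝ)) * fun x : E => ‖x‖ₑ⁻¹ ^ (2 / 3 : ℝ)) x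
      ∂gauss E = 1 := by
    rw [lintegral_congr_ae (g := fun _ => 1)]
    · simp
    · filter_upwards [gauss_absolutelyContinuous.ae_le (ae_ne_zero (E := E))] with x hx
      simp only [Pi.mul_apply]
      rw [← ENNReal.mul_rpow_of_nonneg _ _ (by norm_num),
        ENNReal.mul_inv_cancel (by simpa using hx) (by simp), ENNReal.one_rpow]
  rw [h1] at h
  simp only [← ENNReal.rpow_mul] at h
  have h2 := ENNReal.rpow_le_rpow h (z := 3) (by norm_num)
  rw [ENNReal.one_rpow, ENNReal.mul_rpow_of_nonneg _ _ (by norm_num), ← ENNReal.rpow_mul,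
    ← ENNReal.rpow_mul] at h2
  norm_num at h2
  rw [mul_comm]
  exact h2

end Moments

/-! ### Tuples of independent vectors and their splitting along a line -/

section Tuples

variable {α β : Type*} [MeasurableSpace α] [MeasurableSpace β]

theorem lintegral_pi_cons {k : ℕ} (μ : Measure α) [SigmaFinite μ]
    {f : (Fin (k + 1) → α) → ℝ≥0∞} (hf : Measurable f) :
    ∫⁻ x, f x ∂(Measure.pi fun _ => μ) =
      ∫⁻ a, ∫⁻ x, f (Fin.cons a x) ∂(Measure.pi fun _ : Fin k => μ) ∂μ := by
  have h := (measurePreserving_piFinSuccAbove (fun _ : Fin (k + 1) => μ) 0).symm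
  rw [← h.lintegral_comp hf, lintegral_prod _ (by fun_prop)]
  simp [MeasurableEquiv.piFinSuccAbove, Fin.insertNthEquiv]

theorem measurable_fin_cons {k : ℕ} :
    Measurable fun p : α × (Fin k → α) => (Fin.cons p.1 p.2 : Fin (k + 1) → α) := by
  refine measurable_pi_iff.2 fun i => ?_
  refine Fin.cases ?_ (fun i => ?_) i
  · simpa using measurable_fst
  · simp only [Fin.cons_succ]
    fun_prop

end Tuples

section Incidence

variable {E : Type*} [NormedAddCommGroup E] [InnerProductSpace ℝ E] [FiniteDimensional ℝ E]
  [MeasurableSpace E] [BorelSpace E]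

theorem measurePreserving_pi_gauss_smul_add {e : E} (he : ‖e‖ = 1) (k : ℕ) :
    MeasurePreserving (fun (p : (Fin k → ℝ) × (Fin k → (ℝ ∙ e)ᗮ)) i => p.1 i • e + (p.2 i : E))
      ((Measure.pi fun _ => gauss ℝ).prod (Measure.pi fun _ => gauss (ℝ ∙ e)ᗮ))
      (Measure.pi fun _ => gauss E) := by
  have h1 := (measurePreserving_arrowProdEquivProdArrow ℝ (ℝ ∙ e)ᗮ (Fin k)
    (fun _ => gauss ℝ) (fun _ => gauss (ℝ ∙ e)ᗮ)).symm
  have h2 := measurePreserving_pi (fun _ : Fin k => (gauss ℝ).prod (gauss (ℝ ∙ e)ᗮ))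
    (fun _ => gauss E) (fun _ => measurePreserving_gauss_smul_add he)
  exact h2.comp h1

theorem lintegral_gauss_split {e : E} (he : ‖e‖ = 1) {f : E → ℝ≥0∞} (hf : Measurable f) :
    ∫⁻ x, f x ∂gauss E =
      ∫⁻ t, ∫⁻ u : (ℝ ∙ e)ᗮ, f (t • e + (u : E)) ∂gauss (ℝ ∙ e)ᗮ ∂gauss ℝ := by
  rw [← (measurePreserving_gauss_smul_add he).lintegral_comp hf]
  exact lintegral_prod _ (by fun_prop)

theorem lintegral_pi_gauss_split {e : E} (he : ‖e‖ = 1) {k : ℕ} {f : (Fin k → E) → ℝ≥0∞}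
    (hf : Measurable f) :
    ∫⁻ x, f x ∂(Measure.pi fun _ => gauss E) =
      ∫⁻ t, ∫⁻ u : Fin k → (ℝ ∙ e)ᗮ, f (fun i => t i • e + (u i : E))
        ∂(Measure.pi fun _ => gauss (ℝ ∙ e)ᗮ) ∂(Measure.pi fun _ => gauss ℝ) := by
  rw [← (measurePreserving_pi_gauss_smul_add he k).lintegral_comp hf]
  exact lintegral_prod _
    (hf.comp (measurePreserving_pi_gauss_smul_add he k).measurable).aemeasurable

end Incidence

/-! ### The mixture dominates a weighted product measure -/

section Mixture

theorem measurable_lintegral_reject {E α : Type*} [NormedAddCommGroup E] [InnerProductSpace ℝ E]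
    [FiniteDimensional ℝ E] [MeasurableSpace E] [BorelSpace E] [MeasurableSpace α] {k : ℕ}
    {Φ : α → (Fin k → E) → ℝ≥0∞} (hΦ : Measurable (Function.uncurry Φ)) {v : α → E}
    (hv : Measurable v) :
    Measurable fun a => ∫⁻ g, Φ a (fun i => reject (v a) (g i))
      ∂(Measure.pi fun _ => gauss E) := by
  refine Measurable.lintegral_prod_right' (f := fun p : α × (Fin k → E) =>
    Φ p.1 (fun i => reject (v p.1) (p.2 i))) ?_
  have h : Measurable fun (p : α × (Fin k → E)) (i : Fin k) => reject (v p.1) (p.2 i) :=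
    measurable_pi_iff.2 fun i =>
      measurable_reject (hv.comp measurable_fst) ((measurable_pi_apply i).comp measurable_snd)
  exact hΦ.comp (measurable_fst.prodMk h)

/-- The induction step of `le_lintegral_reject`, after one vector has been fixed: the bound in the
hyperplane orthogonal to `e` gives a bound in the whole space. -/
theorem le_lintegral_reject_of_hyperplane {E : Type*} [NormedAddCommGroup E]
    [InnerProductSpace ℝ E] [FiniteDimensional ℝ E] [MeasurableSpace E] [BorelSpace E] {e : E}
    (he : ‖e‖ = 1) {k j : ℕ} {C : ℝ≥0∞}
    (ih : ∀ F : (Fin k → (ℝ ∙ e)ᗮ) → ℝ≥0∞, Measurable F →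
      C * ∫⁻ x, (∏ i, ‖x i‖ₑ⁻¹) * F x ∂(Measure.pi fun _ => gauss (ℝ ∙ e)ᗮ) ≤
        ∫⁻ v, ‖v‖ₑ ^ j * ∫⁻ g, F (fun i => reject v (g i))
          ∂(Measure.pi fun _ => gauss (ℝ ∙ e)ᗮ) ∂gauss (ℝ ∙ e)ᗮ)
    {Φ : (Fin k → E) → ℝ≥0∞} (hΦ : Measurable Φ) :
    C * ∫⁻ x, (∏ i, ‖x i‖ₑ⁻¹) * Φ x ∂(Measure.pi fun _ => gauss E) ≤
      ∫⁻ h, ‖reject e h‖ₑ ^ j * ∫⁻ g, Φ (fun i => reject (reject e h) (g i))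
          ∂(Measure.pi fun _ => gauss E) ∂gauss E := by
  have hey : ∀ y : (ℝ ∙ e)ᗮ, inner ℝ e (y : E) = 0 := fun y =>
    Submodule.mem_orthogonal_singleton_iff_inner_right.1 y.2
  -- Projecting along a vector orthogonal to `e` leaves the coordinate along `e` unchanged, so these
  -- coordinates are spectators.
  have hrej : ∀ (u w : (ℝ ∙ e)ᗮ) (t : ℝ),
      reject (u : E) (t • e + (w : E)) = t • e + ((reject u w : (ℝ ∙ e)ᗮ) : E) := by
    intro u w t
    rw [reject_add, reject_of_inner_eq_zero]
    · simp [reject]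
    · rw [inner_smul_right, real_inner_comm, hey, mul_zero]
  have hinner : ∀ u : (ℝ ∙ e)ᗮ, ∫⁻ g, Φ (fun i => reject (u : E) (g i))
      ∂(Measure.pi fun _ => gauss E) =
      ∫⁻ t, ∫⁻ w, Φ (fun i => t i • e + ((reject u (w i) : (ℝ ∙ e)ᗮ) : E))
        ∂(Measure.pi fun _ => gauss (ℝ ∙ e)ᗮ) ∂(Measure.pi fun _ => gauss ℝ) := by
    intro u
    have hm : Measurable fun g : Fin k → E => Φ (fun i => reject (u : E) (g i)) :=
      hΦ.comp (measurable_pi_iff.2 fun i => by fun_prop)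
    rw [lintegral_pi_gauss_split he hm]
    simp_rw [hrej]
  calc C * ∫⁻ x, (∏ i, ‖x i‖ₑ⁻¹) * Φ x ∂(Measure.pi fun _ => gauss E)
      = C * ∫⁻ t, ∫⁻ w, (∏ i, ‖t i • e + (w i : E)‖ₑ⁻¹) * Φ (fun i => t i • e + (w i : E))
          ∂(Measure.pi fun _ => gauss (ℝ ∙ e)ᗮ) ∂(Measure.pi fun _ => gauss ℝ) := by
        have hm : Measurable fun x : Fin k → E => (∏ i, ‖x i‖ₑ⁻¹) * Φ x := by fun_prop
        rw [lintegral_pi_gauss_split he hm]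
    -- Dropping the component along `e` shortens each vector, hence enlarges the inverse norms.
    _ ≤ C * ∫⁻ t, ∫⁻ w, (∏ i, ‖w i‖ₑ⁻¹) * Φ (fun i => t i • e + (w i : E))
          ∂(Measure.pi fun _ => gauss (ℝ ∙ e)ᗮ) ∂(Measure.pi fun _ => gauss ℝ) := by
        gcongr with t w i
        rw [enorm_le_iff_norm_le]
        have h1 := norm_add_sq_eq_norm_sq_add_norm_sq_of_inner_eq_zero (t i • e) (w i : E)
          (by rw [inner_smul_left, hey, mul_zero])
        have h2 : ‖w i‖ = ‖(w i : E)‖ := rfl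
        nlinarith [norm_nonneg (w i : E), norm_nonneg (t i • e + (w i : E)),
          mul_self_nonneg ‖t i • e‖]
    _ ≤ ∫⁻ t, C * ∫⁻ w, (∏ i, ‖w i‖ₑ⁻¹) * Φ (fun i => t i • e + (w i : E))
          ∂(Measure.pi fun _ => gauss (ℝ ∙ e)ᗮ) ∂(Measure.pi fun _ => gauss ℝ) :=
        lintegral_const_mul_le _ _
    _ ≤ ∫⁻ t, ∫⁻ u, ‖u‖ₑ ^ j * ∫⁻ w, Φ (fun i => t i • e + ((reject u (w i) : (ℝ ∙ e)ᗮ) : E))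
          ∂(Measure.pi fun _ => gauss (ℝ ∙ e)ᗮ) ∂gauss (ℝ ∙ e)ᗮ
          ∂(Measure.pi fun _ => gauss ℝ) := by
        refine lintegral_mono fun t => ih (fun w => Φ (fun i => t i • e + (w i : E))) ?_
        exact hΦ.comp (measurable_pi_iff.2 fun i => by fun_prop)
    _ = ∫⁻ u, ∫⁻ t, ‖u‖ₑ ^ j * ∫⁻ w, Φ (fun i => t i • e + ((reject u (w i) : (ℝ ∙ e)ᗮ) : E))
          ∂(Measure.pi fun _ => gauss (ℝ ∙ e)ᗮ) ∂(Measure.pi fun _ => gauss ℝ)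
          ∂gauss (ℝ ∙ e)ᗮ := by
        refine lintegral_lintegral_swap (Measurable.aemeasurable ?_)
        refine Measurable.mul (by fun_prop) ?_
        refine measurable_lintegral_reject (E := (ℝ ∙ e)ᗮ) (α := (Fin k → ℝ) × (ℝ ∙ e)ᗮ)
          (v := Prod.snd) (Φ := fun a w => Φ (fun i => a.1 i • e + (w i : E))) ?_ measurable_snd
        exact hΦ.comp (measurable_pi_iff.2 fun i => by fun_prop)
    _ = ∫⁻ u : (ℝ ∙ e)ᗮ, ‖u‖ₑ ^ j * ∫⁻ g, Φ (fun i => reject (u : E) (g i))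
          ∂(Measure.pi fun _ => gauss E) ∂gauss (ℝ ∙ e)ᗮ := by
        refine lintegral_congr fun u => ?_
        rw [hinner, lintegral_const_mul]
        refine measurable_lintegral_reject (E := (ℝ ∙ e)ᗮ) (α := (Fin k → ℝ))
          (v := fun _ => u) (Φ := fun a w => Φ (fun i => a i • e + (w i : E))) ?_ measurable_const
        exact hΦ.comp (measurable_pi_iff.2 fun i => by fun_prop)
    _ = _ := by
        have hm : Measurable fun u : E => ‖u‖ₑ ^ j * ∫⁻ g, Φ (fun i => reject u (g i))
          ∂(Measure.pi fun _ => gauss E) :=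
          Measurable.mul (by fun_prop) (measurable_lintegral_reject (Φ := fun _ => Φ)
            (hΦ.comp measurable_snd) measurable_id)
        rw [lintegral_gauss_split he
          (f := fun h => ‖reject e h‖ₑ ^ j * ∫⁻ g, Φ (fun i => reject (reject e h) (g i))
          ∂(Measure.pi fun _ => gauss E)) (hm.comp (by fun_prop : Measurable (reject e)))]
        -- The component orthogonal to `e` of a Gaussian vector of `E` is a Gaussian vector of the
        -- hyperplane.
        have h1 : ∀ (t : ℝ) (u : (ℝ ∙ e)ᗮ), reject e (t • e + (u : E)) = u := by
          intro t u
          rw [reject_add, reject_smul, reject_self, smul_zero, zero_add,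
            reject_of_inner_eq_zero (hey u)]
        simp only [h1, lintegral_const, measure_univ, mul_one]
        rfl

/-- The Gaussian mixture over `v` of the laws of `k` independent Gaussian vectors in the hyperplane
orthogonal to `v` is bounded below by a multiple of a product measure. -/
theorem le_lintegral_reject {m r : ℕ} (hm : 1 ≤ m) (hr : 1 ≤ r) (k : ℕ) : ∀ (j : ℕ),
    j + k = 2 * m → ∀ (E : Type*) [NormedAddCommGroup E] [InnerProductSpace ℝ E]
    [FiniteDimensional ℝ E] [MeasurableSpace E] [BorelSpace E], Module.finrank ℝ E = r + k →
    ∀ F : (Fin k → E) → ℝ≥0∞, Measurable F →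
      (r * gaussSecondMoment) ^ m *
        ∫⁻ x, (∏ i, ‖x i‖ₑ⁻¹) * F x ∂(Measure.pi fun _ => gauss E) ≤
      ∫⁻ v, ‖v‖ₑ ^ j * ∫⁻ g, F (fun i => reject v (g i)) ∂(Measure.pi fun _ => gauss E)
        ∂gauss E := by
  induction k with
  | zero =>
    intro j hj E _ _ _ _ _ hE F hF
    have hF0 : ∀ x, F x = F 0 := fun x => congrArg F (Subsingleton.elim _ _)
    simp_rw [hF0]
    simp only [Finset.univ_eq_empty, Finset.prod_empty, one_mul, lintegral_const, measure_univ,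
      mul_one]
    rw [lintegral_mul_const _ (by fun_prop)]
    -- With no vectors left, `j = 2 * m` and only the moment of `‖v‖` in dimension `r` has to be
    -- bounded.
    have := pow_le_lintegral_enorm_pow_gauss (E := E) hm
    rw [hE] at this
    rw [← hj] at this
    simp only [add_zero] at this
    gcongr
  | succ k ih =>
    intro j hj E _ _ _ _ _ hE F hF
    have : Nontrivial E := Module.nontrivial_of_finrank_pos (R := ℝ) (by omega)
    set Γ : Measure (Fin k → E) := Measure.pi fun _ => gauss E with hΓ
    have hcons : Measurable fun p : E × (Fin k → E) => F (Fin.cons p.1 p.2) :=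
      hF.comp measurable_fin_cons
    -- The factor `‖p.2‖ₑ⁻¹` is there to cancel the weight in `lintegral_reject_symm`.
    set G : E × E → ℝ≥0∞ := fun p => ‖p.2‖ₑ⁻¹ * (‖p.1‖ₑ ^ j *
      ∫⁻ g, F (Fin.cons p.2 fun i => reject p.1 (g i)) ∂Γ) with hG
    have hGm : Measurable G := by
      refine Measurable.mul (by fun_prop) (Measurable.mul (by fun_prop) ?_)
      refine measurable_lintegral_reject (α := E × E) (Φ := fun a w => F (Fin.cons a.2 w)) ?_
        measurable_fst
      exact hcons.comp (f := fun q : (E × E) × (Fin k → E) => (q.1.2, q.2)) (by fun_prop)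
    have hprod : ∀ (a : E) (x : Fin k → E),
        (∏ i, ‖(Fin.cons a x : Fin (k + 1) → E) i‖ₑ⁻¹) = ‖a‖ₑ⁻¹ * ∏ i, ‖x i‖ₑ⁻¹ := by
      intro a x
      rw [Fin.prod_univ_succ]
      simp
    calc (r * gaussSecondMoment) ^ m *
          ∫⁻ x, (∏ i, ‖x i‖ₑ⁻¹) * F x ∂(Measure.pi fun _ => gauss E)
        = ∫⁻ a, ‖a‖ₑ⁻¹ * ((r * gaussSecondMoment) ^ m *
            ∫⁻ x, (∏ i, ‖x i‖ₑ⁻¹) * F (Fin.cons a x) ∂Γ) ∂gauss E := by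
          rw [lintegral_pi_cons _ (by fun_prop), ← lintegral_const_mul]
          · refine lintegral_congr fun a => ?_
            simp_rw [hprod, mul_assoc]
            rw [lintegral_const_mul _ (by fun_prop)]
            ring
          · simp_rw [hprod]
            refine Measurable.lintegral_prod_right' (f := fun p : E × (Fin k → E) =>
              (‖p.1‖ₑ⁻¹ * ∏ i, ‖p.2 i‖ₑ⁻¹) * F (Fin.cons p.1 p.2)) ?_
            fun_prop
      -- With the first vector `a` fixed, the induction hypothesis is used in the hyperplane
      -- orthogonal to `a`. There the dimension and the number of vectors are both one less, so `r`
      -- is kept, and the exponent `j + 1` supplies the weight `‖reject a h‖ₑ` of the exchange.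
      _ ≤ ∫⁻ a, ∫⁻ h, ‖reject a h‖ₑ * G (reject a h, a) ∂gauss E ∂gauss E := by
          refine lintegral_mono_ae ?_
          filter_upwards [gauss_absolutelyContinuous.ae_le (ae_ne_zero (E := E))] with a ha
          have hna : ‖a‖ ≠ 0 := norm_ne_zero_iff.2 ha
          set e : E := ‖a‖⁻¹ • a with he
          have he1 : ‖e‖ = 1 := by rw [he, norm_smul, norm_inv, norm_norm, inv_mul_cancel₀ hna]
          have he0 : e ≠ 0 := by rw [← norm_ne_zero_iff, he1]; exact one_ne_zero
          have hrea : ∀ h, reject a h = reject e h := fun h =>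
            (reject_smul_left (inv_ne_zero hna) a h).symm
          have h1 := (ℝ ∙ e).finrank_add_finrank_orthogonal
          rw [finrank_span_singleton he0] at h1
          have hslice := le_lintegral_reject_of_hyperplane he1
            (ih (j + 1) (by omega) (ℝ ∙ e)ᗮ (by omega)) (Φ := fun x => F (Fin.cons a x))
            (by fun_prop)
          calc _ ≤ ‖a‖ₑ⁻¹ * ∫⁻ h, ‖reject e h‖ₑ ^ (j + 1) *
                ∫⁻ g, F (Fin.cons a fun i => reject (reject e h) (g i)) ∂Γ ∂gauss E := by
                gcongr
            _ = _ := by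
                rw [← lintegral_const_mul']
                · refine lintegral_congr fun h => ?_
                  rw [hG, hrea]
                  ring
                · simpa using ha
      _ = ∫⁻ v, ∫⁻ g, ‖reject v g‖ₑ * G (v, reject v g) ∂gauss E ∂gauss E :=
          (lintegral_reject_symm (by omega) hGm).symm
      _ ≤ ∫⁻ v, ∫⁻ g, ‖v‖ₑ ^ j * ∫⁻ g', F (Fin.cons (reject v g) fun i => reject v (g' i)) ∂Γ
            ∂gauss E ∂gauss E := by
          refine lintegral_mono fun v => lintegral_mono fun g => ?_
          simp only [hG]
          rw [← mul_assoc]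
          -- Only an inequality, since the product of the weight and its inverse is 0 where `reject
          -- v g = 0`.
          exact mul_le_of_le_one_left zero_le (ENNReal.mul_inv_le_one _)
      _ = _ := by
          refine lintegral_congr fun v => ?_
          have hm1 : Measurable fun g : Fin (k + 1) → E => F (fun i => reject v (g i)) :=
            hF.comp (measurable_pi_iff.2 fun i => by fun_prop)
          rw [lintegral_const_mul, lintegral_pi_cons _ hm1]
          · congr 1
            refine lintegral_congr fun g => lintegral_congr fun g' => ?_
            congr 1
            ext i
            refine Fin.cases ?_ (fun i => ?_) i <;> simp
          · refine measurable_lintegral_reject (α := E)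
              (Φ := fun a w => F (Fin.cons (reject v a) w)) ?_ measurable_const
            exact hcons.comp (f := fun q : E × (Fin k → E) => (reject v q.1, q.2)) (by fun_prop)

end Mixture

/-! ### Reweighted product measures -/

section Normalized

variable {α : Type*} [MeasurableSpace α]

/-- The probability measure proportional to `w • μ`. -/
def reweight (μ : Measure α) (w : α → ℝ≥0∞) : Measure α :=
  (∫⁻ a, w a ∂μ)⁻¹ • μ.withDensity w

theorem isProbabilityMeasure_reweight {μ : Measure α} {w : α → ℝ≥0∞}
    (h0 : ∫⁻ a, w a ∂μ ≠ 0) (ht : ∫⁻ a, w a ∂μ ≠ ⊤) : IsProbabilityMeasure (reweight μ w) := by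
  constructor
  rw [reweight, Measure.smul_apply, withDensity_apply _ MeasurableSet.univ, Measure.restrict_univ,
    smul_eq_mul, ENNReal.inv_mul_cancel h0 ht]

theorem lintegral_pi_prod (μ : Measure α) [SigmaFinite μ] {w : α → ℝ≥0∞} (hw : Measurable w)
    (k : ℕ) : ∫⁻ x, ∏ i, w (x i) ∂(Measure.pi fun _ : Fin k => μ) = (∫⁻ a, w a ∂μ) ^ k := by
  induction k with
  | zero => simp
  | succ k ih =>
    rw [lintegral_pi_cons _ (by fun_prop)]
    simp_rw [Fin.prod_univ_succ, Fin.cons_zero, Fin.cons_succ]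
    simp_rw [lintegral_const_mul _ (by fun_prop : Measurable fun x : Fin k → α => ∏ i, w (x i)), ih]
    rw [lintegral_mul_const _ hw, pow_succ, mul_comm]

theorem lintegral_pi_weight {μ : Measure α} [IsProbabilityMeasure μ] {w : α → ℝ≥0∞}
    (hw : Measurable w) (h0 : ∫⁻ a, w a ∂μ ≠ 0) (ht : ∫⁻ a, w a ∂μ ≠ ⊤) (k : ℕ) :
    ∀ {F : (Fin k → α) → ℝ≥0∞}, Measurable F →
    ∫⁻ x, (∏ i, w (x i)) * F x ∂(Measure.pi fun _ => μ) =
      (∫⁻ a, w a ∂μ) ^ k * ∫⁻ x, F x ∂(Measure.pi fun _ => reweight μ w) := by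
  have := isProbabilityMeasure_reweight h0 ht
  induction k with
  | zero =>
    intro F _
    have hF0 : ∀ x, F x = F Fin.elim0 := fun x => congrArg F (Subsingleton.elim _ _)
    simp_rw [hF0]
    simp
  | succ k ih =>
    intro F hF
    have hc : Measurable fun p : α × (Fin k → α) => F (Fin.cons p.1 p.2) :=
      hF.comp measurable_fin_cons
    rw [lintegral_pi_cons _ (by fun_prop), lintegral_pi_cons _ hF]
    simp_rw [Fin.prod_univ_succ, Fin.cons_zero, Fin.cons_succ, mul_assoc]
    have hca : ∀ a, Measurable fun x : Fin k → α => F (Fin.cons a x) := fun a =>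
      hc.comp measurable_prodMk_left
    have h1 : ∀ a, ∫⁻ x, w a * ((∏ i, w (x i)) * F (Fin.cons a x)) ∂(Measure.pi fun _ : Fin k => μ)
        = (∫⁻ a, w a ∂μ) ^ k * (w a * ∫⁻ x, F (Fin.cons a x)
          ∂(Measure.pi fun _ : Fin k => reweight μ w)) := by
      intro a
      have hm : Measurable fun x : Fin k → α => (∏ i, w (x i)) * F (Fin.cons a x) :=
        Measurable.mul (by fun_prop) (hca a)
      rw [lintegral_const_mul _ hm, ih (hca a)]
      ring
    have hm : Measurable fun a => ∫⁻ x, F (Fin.cons a x)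
        ∂(Measure.pi fun _ : Fin k => reweight μ w) := hc.lintegral_prod_right'
    simp_rw [h1]
    rw [lintegral_const_mul _ (by fun_prop)]
    have h2 : ∀ f : α → ℝ≥0∞, Measurable f →
        ∫⁻ a, f a ∂reweight μ w = (∫⁻ a, w a ∂μ)⁻¹ * ∫⁻ a, w a * f a ∂μ := by
      intro f hf
      rw [reweight, lintegral_smul_measure, lintegral_withDensity_eq_lintegral_mul _ hw hf]
      rfl
    rw [h2 _ hm, pow_succ, mul_assoc, ← mul_assoc (∫⁻ a, w a ∂μ), ENNReal.mul_inv_cancel h0 ht,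
      one_mul]

/-- A choice between two independent copies of a tuple of independent points, made separately in
each coordinate, does not change the law. -/
theorem measurePreserving_pi_select {T : ℕ} (b : Fin T → Bool) (μ : Measure α)
    [IsProbabilityMeasure μ] :
    MeasurePreserving (fun (p : (Fin T → α) × (Fin T → α)) t => if b t then p.1 t else p.2 t)
      ((Measure.pi fun _ => μ).prod (Measure.pi fun _ => μ)) (Measure.pi fun _ => μ) := by
  have h1 := (measurePreserving_arrowProdEquivProdArrow α α (Fin T) (fun _ => μ) (fun _ => μ)).symm
  have h2 := measurePreserving_pi (fun _ : Fin T => μ.prod μ) (fun _ => μ)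
    (f := fun t p => if b t then p.1 else p.2) (fun t => by
      by_cases h : b t
      · simpa [h] using measurePreserving_fst
      · simpa [h] using measurePreserving_snd)
  exact h2.comp h1

end Normalized

/-! ### Indistinguishability in high dimension -/

section Indistinguishable

variable {E : Type*} [NormedAddCommGroup E] [InnerProductSpace ℝ E] [FiniteDimensional ℝ E]
  [MeasurableSpace E] [BorelSpace E]

/-- Marginalization: the bound for more vectors is applied to functions that ignore the first
coordinate. -/
theorem le_lintegral_reject_of_le {Q : Measure E} [IsProbabilityMeasure Q] {c : ℝ≥0∞} {k l : ℕ}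
    (hkl : k ≤ l)
    (h : ∀ F : (Fin l → E) → ℝ≥0∞, Measurable F → c * ∫⁻ x, F x ∂(Measure.pi fun _ => Q) ≤
      ∫⁻ v, ∫⁻ g, F (fun i => reject v (g i)) ∂(Measure.pi fun _ => gauss E) ∂gauss E) :
    ∀ F : (Fin k → E) → ℝ≥0∞, Measurable F → c * ∫⁻ x, F x ∂(Measure.pi fun _ => Q) ≤
      ∫⁻ v, ∫⁻ g, F (fun i => reject v (g i)) ∂(Measure.pi fun _ => gauss E) ∂gauss E := by
  induction l, hkl using Nat.le_induction with
  | base => exact h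
  | succ l hl ih =>
    refine ih fun F hF => ?_
    have ht : Measurable fun x : Fin (l + 1) → E => F (Fin.tail x) :=
      hF.comp (measurable_pi_iff.2 fun i => measurable_pi_apply i.succ)
    have h1 := h _ ht
    rw [lintegral_pi_cons _ ht] at h1
    simp only [Fin.tail_cons, lintegral_const, measure_univ, mul_one] at h1
    refine h1.trans (le_of_eq (lintegral_congr fun v => ?_))
    have hr : Measurable fun g : Fin (l + 1) → E => F (Fin.tail fun i => reject v (g i)) :=
      ht.comp (f := fun (g : Fin (l + 1) → E) i => reject v (g i))
        (measurable_pi_iff.2 fun i => by fun_prop)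
    rw [lintegral_pi_cons _ hr]
    have h2 : ∀ (a : E) (x : Fin l → E), (Fin.tail fun i => reject v
        ((Fin.cons a x : Fin (l + 1) → E) i)) = fun i => reject v (x i) := by
      intro a x
      ext i
      simp [Fin.tail]
    simp [h2]

/-- In a space of large dimension, the Gaussian mixture over `v` of the laws of `T` independent
vectors orthogonal to `v` is close to a product measure which does not depend on `v`. -/
theorem exists_le_lintegral_reject {T : ℕ} (hT : 1 ≤ T)
    (hE : Module.finrank ℝ E = 8 * T ^ 2 + 2 * T) :
    ∃ Q : Measure E, IsProbabilityMeasure Q ∧ ∀ F : (Fin T → E) → ℝ≥0∞, Measurable F →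
      ENNReal.ofReal (3 / 4) * ∫⁻ x, F x ∂(Measure.pi fun _ => Q) ≤
        ∫⁻ v, ∫⁻ g, F (fun i => reject v (g i)) ∂(Measure.pi fun _ => gauss E) ∂gauss E := by
  have : Nontrivial E := Module.nontrivial_of_finrank_pos (R := ℝ) (by omega)
  set r : ℕ := 8 * T ^ 2 with hr
  have hr1 : 1 ≤ r := by have := Nat.one_le_pow 2 T hT; omega
  set α := gaussSecondMoment with hα
  have hα0 : α ≠ 0 := gaussSecondMoment_ne_zero
  have hαt : α ≠ ⊤ := gaussSecondMoment_ne_top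
  -- The weight `‖v‖ ^ j` disappears only if the number of vectors is the even number `2 * m`; so `2
  -- * T` vectors are treated with `m = T`, and half of them are discarded afterwards.
  have hclaim := le_lintegral_reject hT hr1 (2 * T) 0 (by omega) E hE
  set z : ℝ≥0∞ := ∫⁻ x : E, ‖x‖ₑ⁻¹ ∂gauss E with hz
  have hz1 := one_le_lintegral_inv_enorm_gauss (E := E)
  rw [← hz, hE] at hz1
  have hz0 : z ≠ 0 := by
    intro h
    rw [h] at hz1
    simp at hz1
  have hrα : (r : ℝ≥0∞) * α ≠ 0 := mul_ne_zero (by simp; omega) hα0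
  -- Finiteness needs no separate computation: for `F = 1` the mixture bound has right-hand side 1
  -- and a nonzero multiple of `z ^ (2 * T)` on the left.
  have hzt : z ≠ ⊤ := by
    intro htop
    have h1 := hclaim 1 measurable_const
    simp only [Pi.one_apply, lintegral_const, measure_univ, mul_one, pow_zero] at h1
    rw [lintegral_pi_prod (gauss E) (w := fun x => ‖x‖ₑ⁻¹) (by fun_prop), ← hz, htop,
      ENNReal.top_pow (by omega), ENNReal.mul_top (pow_ne_zero _ hrα)] at h1
    simp at h1
  have := isProbabilityMeasure_reweight (μ := gauss E) (w := fun x => ‖x‖ₑ⁻¹) hz0 hzt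
  refine ⟨reweight (gauss E) fun x => ‖x‖ₑ⁻¹, this, le_lintegral_reject_of_le (l := 2 * T)
    (by omega) fun F hF => ?_⟩
  have h1 := hclaim F hF
  rw [lintegral_pi_weight (w := fun x => ‖x‖ₑ⁻¹) (by fun_prop) hz0 hzt _ hF, ← hz, ← mul_assoc]
    at h1
  simp only [pow_zero, one_mul] at h1
  refine le_trans ?_ h1
  gcongr
  have hd0 : ((r + 2 * T : ℕ) : ℝ≥0∞) * α ≠ 0 := mul_ne_zero (by simp; omega) hα0
  have hdt : ((r + 2 * T : ℕ) : ℝ≥0∞) * α ≠ ⊤ :=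
    ENNReal.mul_ne_top (ENNReal.natCast_ne_top _) hαt
  have h2 : (((r + 2 * T : ℕ) : ℝ≥0∞) * α)⁻¹ ≤ z ^ 2 := by
    rw [ENNReal.inv_le_iff_le_mul (fun _ => hd0) (fun h => absurd h hdt), mul_comm]
    exact hz1
  calc ENNReal.ofReal (3 / 4) ≤ ENNReal.ofReal (((r : ℝ) / (r + 2 * T : ℕ)) ^ T) := by
        refine ENNReal.ofReal_le_ofReal ?_
        have hT' : (1 : ℝ) ≤ T := by exact_mod_cast hT
        -- Bernoulli: the power is at least `1 - 2 T ^ 2 / (8 T ^ 2 + 2 T)`, and the subtracted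
        -- fraction is at most `1/4`. This dictates the dimension.
        have h3 := one_add_mul_le_pow (a := -(2 * T / (r + 2 * T : ℕ) : ℝ)) ?_ T
        · refine le_trans ?_ (h3.trans (le_of_eq ?_))
          · rw [hr]; push_cast
            have : 0 < (8 * (T : ℝ) ^ 2 + 2 * T) := by positivity
            rw [mul_neg, ← mul_div_assoc, ← sub_eq_add_neg, le_sub_iff_add_le, ← le_sub_iff_add_le',
              div_le_iff₀ this]
            nlinarith
          · congr 1
            have : (0 : ℝ) < (r + 2 * T : ℕ) := by positivity
            field_simp
            push_cast
            ring
        · have : (2 * T / (r + 2 * T : ℕ) : ℝ) ≤ 1 := by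
            rw [div_le_one (by positivity)]
            push_cast
            have : (0 : ℝ) ≤ r := by positivity
            linarith
          linarith
    -- The second moment `α` cancels, so its value is irrelevant.
    _ = (r * α) ^ T * ((((r + 2 * T : ℕ) : ℝ≥0∞) * α)⁻¹) ^ T := by
        rw [← mul_pow, ENNReal.ofReal_pow (by positivity), ENNReal.ofReal_div_of_pos (by positivity),
          ENNReal.ofReal_natCast, ENNReal.ofReal_natCast, ← div_eq_mul_inv,
          ENNReal.mul_div_mul_right _ _ hα0 hαt]
    _ ≤ (r * α) ^ T * (z ^ 2) ^ T := by gcongr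
    _ = _ := by rw [← pow_mul]

/-- The version of `exists_le_lintegral_reject` with two independent Gaussian vectors, of which one
is used in the coordinates marked by `b`, and the other one in the remaining coordinates. -/
theorem le_lintegral_reject_select {T : ℕ} {Q : Measure E} [IsProbabilityMeasure Q] {c : ℝ≥0∞}
    (h : ∀ F : (Fin T → E) → ℝ≥0∞, Measurable F → c * ∫⁻ x, F x ∂(Measure.pi fun _ => Q) ≤
      ∫⁻ v, ∫⁻ g, F (fun i => reject v (g i)) ∂(Measure.pi fun _ => gauss E) ∂gauss E)
    (b : Fin T → Bool) {F : (Fin T → E) → ℝ≥0∞} (hF : Measurable F) :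
    c * (c * ∫⁻ x, F x ∂(Measure.pi fun _ => Q)) ≤
      ∫⁻ p : E × E, ∫⁻ g, F (fun t => reject (if b t then p.1 else p.2) (g t))
        ∂(Measure.pi fun _ => gauss E) ∂((gauss E).prod (gauss E)) := by
  set Γ : Measure (Fin T → E) := Measure.pi fun _ => gauss E with hΓ
  set S : (Fin T → E) → (Fin T → E) → (Fin T → E) := fun x y t => if b t then x t else y t with hS
  have hSm : Measurable fun p : (Fin T → E) × (Fin T → E) => S p.1 p.2 :=
    (measurePreserving_pi_select b (gauss E)).measurable
  have hrm : Measurable fun (q : E × (Fin T → E)) (i : Fin T) => reject q.1 (q.2 i) :=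
    measurable_pi_iff.2 fun i => by fun_prop
  have hmain : Measurable fun q : (E × (Fin T → E)) × (E × (Fin T → E)) =>
      F (S (fun i => reject q.1.1 (q.1.2 i)) (fun i => reject q.2.1 (q.2.2 i))) :=
    hF.comp (hSm.comp ((hrm.comp measurable_fst).prodMk (hrm.comp measurable_snd)))
  calc c * (c * ∫⁻ x, F x ∂(Measure.pi fun _ => Q))
      = c * ∫⁻ x, c * ∫⁻ y, F (S x y) ∂(Measure.pi fun _ => Q) ∂(Measure.pi fun _ => Q) := by
        have hm : Measurable fun p : (Fin T → E) × (Fin T → E) => F (S p.1 p.2) := hF.comp hSm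
        have h1 : ∀ x, ∫⁻ y, c * F (S x y) ∂(Measure.pi fun _ => Q) =
            c * ∫⁻ y, F (S x y) ∂(Measure.pi fun _ => Q) := fun x =>
          lintegral_const_mul _ (hm.comp measurable_prodMk_left)
        simp_rw [← h1]
        rw [← lintegral_prod _ (hm.const_mul c).aemeasurable, lintegral_const_mul _ hm,
          ← (measurePreserving_pi_select b Q).lintegral_comp hF]
    -- The bound is used once for the coordinates driven by `v`, and in the next step, with these
    -- frozen, for those driven by `w`.
    _ ≤ ∫⁻ v, ∫⁻ g, c * ∫⁻ y, F (S (fun i => reject v (g i)) y) ∂(Measure.pi fun _ => Q)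
          ∂Γ ∂gauss E :=
        h _ ((hF.comp hSm).lintegral_prod_right'.const_mul c)
    _ ≤ ∫⁻ v, ∫⁻ g, ∫⁻ w, ∫⁻ g', F (S (fun i => reject v (g i)) (fun i => reject w (g' i)))
          ∂Γ ∂gauss E ∂Γ ∂gauss E := by
        gcongr with v g
        exact h _ (hF.comp (hSm.comp (measurable_const.prodMk measurable_id)))
    _ = ∫⁻ v, ∫⁻ w, ∫⁻ g, ∫⁻ g', F (S (fun i => reject v (g i)) (fun i => reject w (g' i)))
          ∂Γ ∂Γ ∂gauss E ∂gauss E := by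
        refine lintegral_congr fun v => lintegral_lintegral_swap (Measurable.aemeasurable ?_)
        refine Measurable.lintegral_prod_right' (f := fun q : ((Fin T → E) × E) × (Fin T → E) =>
          F (S (fun i => reject v (q.1.1 i)) (fun i => reject q.1.2 (q.2 i)))) ?_
        exact hmain.comp (f := fun q : ((Fin T → E) × E) × (Fin T → E) =>
          ((v, q.1.1), (q.1.2, q.2))) (by fun_prop)
    _ = ∫⁻ v, ∫⁻ w, ∫⁻ g, F (fun t => reject (if b t then v else w) (g t)) ∂Γ
          ∂gauss E ∂gauss E := by
        refine lintegral_congr fun v => lintegral_congr fun w => ?_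
        have hm : Measurable fun g : Fin T → E =>
            F (fun t => reject (if b t then v else w) (g t)) :=
          hF.comp (measurable_pi_iff.2 fun i => by fun_prop)
        -- Each coordinate reads only one of the two Gaussian tuples, so a single tuple has the same
        -- effect.
        rw [← (measurePreserving_pi_select b (gauss E)).lintegral_comp hm, lintegral_prod]
        · refine lintegral_congr fun g => lintegral_congr fun g' => congrArg F ?_
          ext t
          by_cases hb : b t <;> simp [hS, hb]
        · exact (hm.comp hSm).aemeasurable
    _ = _ := by
        rw [lintegral_prod]
        refine Measurable.aemeasurable ?_
        refine Measurable.lintegral_prod_right' (f := fun q : (E × E) × (Fin T → E) =>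
          F (fun t => reject (if b t then q.1.1 else q.1.2) (q.2 t))) ?_
        refine hF.comp (measurable_pi_iff.2 fun t => ?_)
        by_cases hb : b t <;> simp only [hb, if_true, Bool.false_eq_true, if_false] <;> fun_prop

end Indistinguishable

/-! ### Directions of Gaussian vectors -/

section Normalize

variable {F : Type*} [NormedAddCommGroup F] [InnerProductSpace ℝ F] [Nontrivial F]

open Classical in
/-- The direction of a vector (an arbitrary one for the zero vector). -/
def direction (x : F) : Metric.sphere (0 : F) 1 :=
  ⟨if x = 0 then (exists_norm_eq F zero_le_one).choose else ‖x‖⁻¹ • x, by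
    rw [mem_sphere_zero_iff_norm]
    split_ifs with h
    · exact (exists_norm_eq F zero_le_one).choose_spec
    · rw [norm_smul, norm_inv, norm_norm, inv_mul_cancel₀ (norm_ne_zero_iff.2 h)]⟩

theorem coe_direction {x : F} (hx : x ≠ 0) : (direction x : F) = ‖x‖⁻¹ • x := by
  simp [direction, hx]

variable [FiniteDimensional ℝ F] [MeasurableSpace F] [BorelSpace F]

theorem measurable_direction : Measurable (direction : F → Metric.sphere (0 : F) 1) := by
  refine Measurable.subtype_mk ?_
  exact Measurable.ite (measurableSet_singleton 0) measurable_const (by fun_prop)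

/-- The direction of a Gaussian vector is uniformly distributed. -/
theorem map_direction_gauss : (gauss F).map direction =
    ((volume : Measure F).toSphere univ)⁻¹ • (volume : Measure F).toSphere := by
  set σ := (volume : Measure F).toSphere with hσ
  set I : ℝ≥0∞ := ∫⁻ r : Ioi (0 : ℝ), gaussDensity (r : ℝ)
    ∂(Measure.volumeIoiPow (Module.finrank ℝ F - 1)) with hI
  have key : ∀ s, MeasurableSet s → (gauss F).map direction s = σ s * I := by
    intro s hs
    have h1 : (gauss F).map direction s =
        ∫⁻ x : F, gaussDensity x * s.indicator 1 (direction x) := by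
      rw [← lintegral_indicator_one hs, lintegral_map (measurable_one.indicator hs)
        measurable_direction, lintegral_gauss]
    -- In polar coordinates the density depends on the radius alone, so the integral factors. The
    -- radial factor `I` is identified below from the total mass 1.
    have hm := (volume : Measure F).measurePreserving_homeomorphUnitSphereProd
    rw [h1, ← restrict_compl_singleton (μ := (volume : Measure F)) 0,
      ← lintegral_subtype_comap (measurableSet_singleton _).compl]
    have h2 : ∀ x : ({0}ᶜ : Set F), gaussDensity (x : F) * s.indicator 1 (direction (x : F)) =
        (fun p : Metric.sphere (0 : F) 1 × Ioi (0 : ℝ) =>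
          s.indicator 1 p.1 * gaussDensity (p.2 : ℝ)) (homeomorphUnitSphereProd F x) := by
      intro x
      have hx : (x : F) ≠ 0 := x.2
      have h3 : direction (x : F) = (homeomorphUnitSphereProd F x).1 := by
        ext
        rw [coe_direction hx]
        simp
      rw [h3, mul_comm]
      simp [gaussDensity]
    simp_rw [h2]
    rw [hm.lintegral_comp (f := fun p : Metric.sphere (0 : F) 1 × Ioi (0 : ℝ) =>
      s.indicator 1 p.1 * gaussDensity (p.2 : ℝ)), lintegral_prod_mul
      (f := s.indicator 1) (g := fun r : Ioi (0 : ℝ) => gaussDensity (r : ℝ)),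
      lintegral_indicator_one hs]
    · exact (measurable_one.indicator hs).aemeasurable
    · fun_prop
    · exact ((measurable_one.indicator hs).comp measurable_fst).mul (by fun_prop)
  have h1 := key univ MeasurableSet.univ
  rw [Measure.map_apply measurable_direction MeasurableSet.univ, preimage_univ, measure_univ] at h1
  have hI : I = (σ univ)⁻¹ := ENNReal.eq_inv_of_mul_eq_one_left (by rw [mul_comm]; exact h1.symm)
  ext s hs
  rw [key s hs, hI, Measure.smul_apply, smul_eq_mul, mul_comm]

end Normalize

/-! ### Uniform distributions on great subspheres -/

section Sphere

theorem measurable_sigma_mk (d : ℕ) : Measurable fun y : USphere d => (⟨d, y⟩ : SphereUnion) := by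
  rw [measurable_iff_le_map]
  exact iInf_le (fun a => MeasurableSpace.map (Sigma.mk a) (inferInstance :
    MeasurableSpace (USphere a))) d

theorem nontrivial_euclideanSpace {d : ℕ} (hd : 2 ≤ d) : Nontrivial (EuclideanSpace ℝ (Fin d)) :=
  Module.nontrivial_of_finrank_pos (R := ℝ) (by rw [finrank_euclideanSpace_fin]; omega)

variable {d : ℕ}

/-- The direction of a vector of `ℝ ^ d`, as a point of the disjoint union of the spheres. -/
def sphereDirection [Nontrivial (EuclideanSpace ℝ (Fin d))] (x : EuclideanSpace ℝ (Fin d)) :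
    SphereUnion :=
  ⟨d, direction x⟩

theorem measurable_sphereDirection [Nontrivial (EuclideanSpace ℝ (Fin d))] :
    Measurable (sphereDirection (d := d)) :=
  (measurable_sigma_mk d).comp measurable_direction

theorem measurable_sphereDirection_reject [Nontrivial (EuclideanSpace ℝ (Fin d))]
    (v : EuclideanSpace ℝ (Fin d)) : Measurable fun g => sphereDirection (reject v g) :=
  measurable_sphereDirection.comp (by fun_prop : Measurable (reject v))

theorem nontrivial_orthHyperplane (hd : 2 ≤ d) (v : USphere d) :
    Nontrivial (orthHyperplane v) := by
  have hv : (v : EuclideanSpace ℝ (Fin d)) ≠ 0 := by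
    intro h
    have := v.2
    simp [h] at this
  refine Module.nontrivial_of_finrank_pos (R := ℝ) ?_
  have h1 := (ℝ ∙ (v : EuclideanSpace ℝ (Fin d))).finrank_add_finrank_orthogonal
  rw [finrank_span_singleton hv, finrank_euclideanSpace_fin] at h1
  change 0 < Module.finrank ℝ (ℝ ∙ (v : EuclideanSpace ℝ (Fin d)))ᗮ
  omega

/-- The uniform distribution on a great subsphere is the law of the direction of the orthogonal
component of a Gaussian vector. -/
theorem subsphereMeasure_eq_map (hd : 2 ≤ d) [Nontrivial (EuclideanSpace ℝ (Fin d))]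
    (v : USphere d) :
    subsphereMeasure v = (gauss (EuclideanSpace ℝ (Fin d))).map
      (fun g => sphereDirection (reject (v : EuclideanSpace ℝ (Fin d)) g)) := by
  have := nontrivial_orthHyperplane hd v
  have hv : ‖(v : EuclideanSpace ℝ (Fin d))‖ = 1 := mem_sphere_zero_iff_norm.mp v.2
  have hmeas : Measurable fun g =>
      sphereDirection (reject (v : EuclideanSpace ℝ (Fin d)) g) :=
    measurable_sphereDirection_reject _
  rw [subsphereMeasure, subsphereSurface, ← map_direction_gauss,
    Measure.map_map (measurable_subsphereInclusion v) measurable_direction]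
  ext s hs
  rw [Measure.map_apply ((measurable_subsphereInclusion v).comp measurable_direction) hs,
    Measure.map_apply hmeas hs, ← (measurePreserving_gauss_smul_add hv).measure_preimage
      (hmeas hs).nullMeasurableSet]
  -- The zero vector must be excluded: there the directions taken in the hyperplane and in the whole
  -- space are unrelated arbitrary choices.
  have h1 : ∀ᵐ u ∂gauss (orthHyperplane v), u ≠ 0 := gauss_absolutelyContinuous.ae_le ae_ne_zero
  have h2 : (fun p : ℝ × orthHyperplane v => p.1 • (v : EuclideanSpace ℝ (Fin d)) +
      (p.2 : EuclideanSpace ℝ (Fin d))) ⁻¹' ((fun g => sphereDirection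
        (reject (v : EuclideanSpace ℝ (Fin d)) g)) ⁻¹' s) =
      univ ×ˢ {u : orthHyperplane v | sphereDirection (u : EuclideanSpace ℝ (Fin d)) ∈ s} := by
    ext p
    have h3 : reject (v : EuclideanSpace ℝ (Fin d)) (p.1 • (v : EuclideanSpace ℝ (Fin d)) +
        (p.2 : EuclideanSpace ℝ (Fin d))) = p.2 := by
      rw [reject_add, reject_smul, reject_self, smul_zero, zero_add, reject_of_inner_eq_zero]
      exact Submodule.mem_orthogonal_singleton_iff_inner_right.1 p.2.2
    simp only [mem_preimage, h3, mem_prod, mem_univ, true_and, mem_ofPred_eq]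
  rw [h2, Measure.prod_prod, measure_univ, one_mul]
  refine measure_congr ?_
  filter_upwards [h1] with u hu
  have hu' : (u : EuclideanSpace ℝ (Fin d)) ≠ 0 := by simpa using hu
  refine propext (Eq.to_iff (congrArg (· ∈ s) ?_))
  simp only [Function.comp_apply, subsphereInclusion, sphereDirection]
  congr 1
  ext1
  change ((direction u : orthHyperplane v) : EuclideanSpace ℝ (Fin d)) = _
  rw [coe_direction hu', coe_direction hu]
  rfl

theorem measurableSet_greatSubsphere (v : USphere d) : MeasurableSet (greatSubsphere v) := by
  have h : MeasurableSet {x : USphere d |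
      inner ℝ (v : EuclideanSpace ℝ (Fin d)) (x : EuclideanSpace ℝ (Fin d)) = 0} :=
    measurableSet_eq_fun (by fun_prop) measurable_const
  refine MeasurableSpace.measurableSet_iInf.2 fun a => ?_
  rw [MeasurableSpace.map_def]
  by_cases ha : d = a
  · subst ha
    rwa [greatSubsphere, preimage_image_eq _ sigma_mk_injective]
  · rw [greatSubsphere, preimage_image_sigmaMk_of_ne (Ne.symm ha)]
    exact MeasurableSet.empty

theorem measurable_hyperplaneIndicator (v : USphere d) : Measurable (hyperplaneIndicator v) := by
  refine measurable_to_bool ?_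
  convert measurableSet_greatSubsphere v using 1
  ext x
  simp [hyperplaneIndicator]

theorem subsphereMeasure_compl (v : USphere d) : subsphereMeasure v (greatSubsphere v)ᶜ = 0 := by
  rw [subsphereMeasure, Measure.map_apply (measurable_subsphereInclusion v)
    (measurableSet_greatSubsphere v).compl]
  have h : subsphereInclusion v ⁻¹' (greatSubsphere v)ᶜ = ∅ := by
    ext x
    simp only [mem_preimage, mem_compl_iff, mem_empty_iff_false, iff_false, not_not]
    exact ⟨_, Submodule.mem_orthogonal_singleton_iff_inner_right.1 x.1.2, rfl⟩
  rw [h, measure_empty]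

theorem inner_reject_right {E : Type*} [NormedAddCommGroup E] [InnerProductSpace ℝ E] (u v g : E) :
    inner ℝ v (reject u g) = inner ℝ (reject u v) g := by
  simp only [reject, inner_sub_right, inner_sub_left, inner_smul_left, inner_smul_right]
  rw [real_inner_comm v u]
  simp
  ring

/-- By self-adjointness of the projection, a Gaussian `g` whose projected direction lies in `H_v` is
orthogonal to the nonzero vector `reject u v`, a null event. -/
theorem subsphereMeasure_greatSubsphere_of_reject (hd : 2 ≤ d) {u v : USphere d}
    (h : reject (u : EuclideanSpace ℝ (Fin d)) (v : EuclideanSpace ℝ (Fin d)) ≠ 0) :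
    subsphereMeasure u (greatSubsphere v) = 0 := by
  have := nontrivial_euclideanSpace hd
  rw [subsphereMeasure_eq_map hd u, Measure.map_apply
    (measurable_sphereDirection_reject _) (measurableSet_greatSubsphere v)]
  have h1 := gauss_absolutelyContinuous.ae_le (ae_inner_ne_zero h)
  refine measure_mono_null (fun g hg => ?_) (ae_iff.1 h1)
  simp only [ne_eq, not_not, mem_ofPred_eq]
  obtain ⟨y, hy, hyg⟩ := hg
  have hy2 : y = direction (reject (u : EuclideanSpace ℝ (Fin d)) g) := sigma_mk_injective hyg
  rw [← inner_reject_right]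
  by_cases h0 : reject (u : EuclideanSpace ℝ (Fin d)) g = 0
  · rw [h0, inner_zero_right]
  · rw [mem_ofPred_eq, hy2, coe_direction h0, inner_smul_right] at hy
    exact (mul_eq_zero.1 hy).resolve_left (inv_ne_zero (norm_ne_zero_iff.2 h0))

theorem greatSubsphere_eq_of_reject {u v : USphere d}
    (h : reject (u : EuclideanSpace ℝ (Fin d)) (v : EuclideanSpace ℝ (Fin d)) = 0) :
    greatSubsphere v = greatSubsphere u := by
  have hv0 : (v : EuclideanSpace ℝ (Fin d)) ≠ 0 := by
    intro h
    have := v.2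
    simp [h] at this
  set c : ℝ := inner ℝ (u : EuclideanSpace ℝ (Fin d)) (v : EuclideanSpace ℝ (Fin d)) /
    ‖(u : EuclideanSpace ℝ (Fin d))‖ ^ 2 with hc
  have hv : (v : EuclideanSpace ℝ (Fin d)) = c • (u : EuclideanSpace ℝ (Fin d)) := sub_eq_zero.1 h
  have hc0 : c ≠ 0 := by
    intro h0
    rw [h0, zero_smul] at hv
    exact hv0 hv
  rw [greatSubsphere, greatSubsphere]
  congr 1
  ext x
  simp [hv, inner_smul_left, hc0]

/-- A great subsphere is a null set for the uniform distributions on all other ones. -/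
theorem subsphereMeasure_greatSubsphere_eq_zero {d' : ℕ} (hd : 2 ≤ d) (u : USphere d)
    (v : USphere d') (h : greatSubsphere v ≠ greatSubsphere u) :
    subsphereMeasure u (greatSubsphere v) = 0 := by
  by_cases hdd : d = d'
  · subst hdd
    exact subsphereMeasure_greatSubsphere_of_reject hd
      fun h0 => h (greatSubsphere_eq_of_reject h0)
  · refine measure_mono_null (t := (greatSubsphere u)ᶜ) (fun x hx hxu => hdd ?_) (subsphereMeasure_compl u)
    obtain ⟨y, -, rfl⟩ := hx
    obtain ⟨z, -, hz⟩ := hxu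
    exact congrArg Sigma.fst hz

end Sphere

/-! ### Covering numbers and the dimension -/

section Capacity

theorem hyperplaneIndicator_preimage {d : ℕ} (v : USphere d) :
    {x | hyperplaneIndicator v x = true} = greatSubsphere v := by
  ext x
  simp [hyperplaneIndicator]

theorem measurable_of_mem_hyperplaneClass {f : SphereUnion → Bool} (hf : f ∈ hyperplaneClass) :
    Measurable f := by
  obtain ⟨d, v, rfl⟩ := hf
  exact measurable_hyperplaneIndicator v

theorem const_false_mem_hyperplaneClass : (fun _ => false) ∈ hyperplaneClass := by
  -- In dimension 1 the sphere is `{±1}` and no point of it is orthogonal to `v`, so the indicator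
  -- vanishes identically.
  refine ⟨1, ⟨EuclideanSpace.single 0 1, by simp⟩, ?_⟩
  ext x
  refine (Bool.eq_false_iff.2 fun h => ?_).symm
  have hx := (hyperplaneIndicator_preimage _).subset h
  obtain ⟨y, hy, -⟩ := hx
  have h1 := y.2
  rw [mem_sphere_zero_iff_norm, EuclideanSpace.norm_eq] at h1
  rw [mem_ofPred_eq, EuclideanSpace.inner_single_left] at hy
  simp only [map_one, one_mul] at hy
  simp [hy] at h1

/-- Distinct hyperplane indicators are almost surely not both `1`. -/
theorem measure_inter_eq_zero_of_mem {ν : ProbabilityMeasure SphereUnion}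
    (hν : ν ∈ subsphereClass) {f g : SphereUnion → Bool} (hf : f ∈ hyperplaneClass)
    (hg : g ∈ hyperplaneClass) (hfg : f ≠ g) :
    (ν : Measure SphereUnion) ({x | f x = true} ∩ {x | g x = true}) = 0 := by
  obtain ⟨d, hd, u, rfl⟩ := hν
  obtain ⟨d₁, v, rfl⟩ := hf
  obtain ⟨d₂, w, rfl⟩ := hg
  rw [hyperplaneIndicator_preimage, hyperplaneIndicator_preimage]
  change subsphereMeasure u _ = 0
  by_cases hv : greatSubsphere v = greatSubsphere u
  · refine measure_mono_null inter_subset_right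
      (subsphereMeasure_greatSubsphere_eq_zero hd u w fun hw => hfg ?_)
    ext x
    unfold hyperplaneIndicator
    exact decide_eq_decide.2 (by rw [hv, hw])
  · exact measure_mono_null inter_subset_left (subsphereMeasure_greatSubsphere_eq_zero hd u v hv)

theorem measure_eq_zero_of_mem_mixtures {X : Type*} [MeasurableSpace X]
    {U : Set (ProbabilityMeasure X)} {μ : ProbabilityMeasure X} (hμ : μ ∈ mixtures U) {s : Set X}
    (hs : MeasurableSet s) (h : ∀ ν ∈ U, (ν : Measure X) s = 0) : (μ : Measure X) s = 0 := by
  obtain ⟨π, _, hμ⟩ := hμ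
  have hm : Measurable fun ν : U => ((ν : ProbabilityMeasure X) : Measure X) :=
    measurable_subtype_coe.comp measurable_subtype_coe
  rw [hμ, Measure.bind_apply hs hm.aemeasurable]
  simp [h]

variable {μ : ProbabilityMeasure SphereUnion} {f g : SphereUnion → Bool}

theorem measure_inter_eq_zero (hμ : μ ∈ mixtures subsphereClass) (hf : f ∈ hyperplaneClass)
    (hg : g ∈ hyperplaneClass) (hfg : f ≠ g) :
    (μ : Measure SphereUnion) ({x | f x = true} ∩ {x | g x = true}) = 0 :=
  measure_eq_zero_of_mem_mixtures hμ
    ((measurable_of_mem_hyperplaneClass hf (measurableSet_singleton true)).inter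
      (measurable_of_mem_hyperplaneClass hg (measurableSet_singleton true)))
    fun _ hν => measure_inter_eq_zero_of_mem hν hf hg hfg

/-- Where `g = 1`, almost surely `f = 0`, so nearly disjoint supports turn mass into disagreement.
-/
theorem measure_le_disagreement (hμ : μ ∈ mixtures subsphereClass) (hf : f ∈ hyperplaneClass)
    (hg : g ∈ hyperplaneClass) (hfg : f ≠ g) :
    (μ : Measure SphereUnion) {x | g x = true} ≤ disagreement μ f g := by
  have h := measure_union_le (μ := (μ : Measure SphereUnion)) {x | f x ≠ g x}
    ({x | f x = true} ∩ {x | g x = true})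
  rw [measure_inter_eq_zero hμ hf hg hfg, add_zero] at h
  refine (measure_mono fun x hx => ?_).trans h
  by_cases hfx : f x = true
  · exact Or.inr ⟨hfx, hx⟩
  · refine Or.inl fun hfg' => hfx (hfg'.trans hx)

theorem disagreement_le_add :
    disagreement μ f g ≤ (μ : Measure SphereUnion) {x | f x = true} +
      (μ : Measure SphereUnion) {x | g x = true} := by
  refine (measure_mono fun x hx => ?_).trans (measure_union_le _ _)
  by_cases hfx : f x = true
  · exact Or.inl hfx
  · refine Or.inr ?_
    have hx : f x ≠ g x := hx
    rw [Bool.not_eq_true] at hfx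
    rw [hfx] at hx
    exact (Bool.eq_true_of_not_eq_false hx.symm)

theorem disagreement_self : disagreement μ f f = 0 := by
  simp [disagreement]

/-- Almost disjoint sets of mass at least `ε` in a probability space number at most `1 / ε`. -/
theorem encard_heavy_le (hμ : μ ∈ mixtures subsphereClass) {ε : ℝ} (hε : 0 < ε) :
    {f ∈ hyperplaneClass | ENNReal.ofReal ε ≤ (μ : Measure SphereUnion) {x | f x = true}}.encard ≤
      (⌊1 / ε⌋₊ : ℕ∞) := by
  by_contra! hlt
  obtain ⟨t, htA, ht⟩ := Set.exists_subset_encard_eq (Order.add_one_le_of_lt hlt)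
  have htf : t.Finite := Set.finite_of_encard_eq_coe (k := ⌊1 / ε⌋₊ + 1) (by rw [ht]; rfl)
  have hcard : htf.toFinset.card = ⌊1 / ε⌋₊ + 1 := by
    rw [htf.encard_eq_coe_toFinset_card] at ht
    exact_mod_cast ht
  have hsum : ∑ f ∈ htf.toFinset, (μ : Measure SphereUnion) {x | f x = true} ≤
      (μ : Measure SphereUnion) univ := by
    refine sum_measure_le_measure_univ (fun f hf => ?_) fun f hf g hg hfg => ?_
    · exact (measurable_of_mem_hyperplaneClass (htA (htf.mem_toFinset.1 hf)).1
        (measurableSet_singleton true)).nullMeasurableSet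
    · exact measure_inter_eq_zero hμ (htA (htf.mem_toFinset.1 hf)).1
        (htA (htf.mem_toFinset.1 hg)).1 hfg
  have hlow := Finset.card_nsmul_le_sum htf.toFinset
    (fun f => (μ : Measure SphereUnion) {x | f x = true}) (ENNReal.ofReal ε)
    fun f hf => (htA (htf.mem_toFinset.1 hf)).2
  have h1 := hlow.trans hsum
  rw [measure_univ, hcard, ← ENNReal.ofReal_nsmul, ENNReal.ofReal_le_one, nsmul_eq_mul] at h1
  have h2 := Nat.lt_floor_add_one (1 / ε)
  rw [div_lt_iff₀ hε] at h2
  push_cast at h1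
  linarith

/-- The heavy functions cover themselves, and the zero function covers all light ones. -/
theorem coveringNumber_le (hμ : μ ∈ mixtures subsphereClass) {ε : ℝ} (hε : 0 < ε) :
    coveringNumber μ ε hyperplaneClass ≤ (⌊1 / ε⌋₊ : ℕ∞) + 1 := by
  set A := {f ∈ hyperplaneClass |
    ENNReal.ofReal ε ≤ (μ : Measure SphereUnion) {x | f x = true}} with hA
  have hcov : IsCovering μ ε hyperplaneClass (insert (fun _ => false) A) := by
    refine ⟨insert_subset const_false_mem_hyperplaneClass fun f hf => hf.1, fun f hf => ?_⟩
    by_cases hfA : f ∈ A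
    · refine (iInf₂_le f (mem_insert_of_mem _ hfA)).trans ?_
      rw [disagreement_self]
      exact zero_le
    · refine (iInf₂_le _ (mem_insert _ _)).trans (disagreement_le_add.trans ?_)
      have : ¬ ENNReal.ofReal ε ≤ (μ : Measure SphereUnion) {x | f x = true} :=
        fun h => hfA ⟨hf, h⟩
      simpa using (not_le.1 this).le
  refine (iInf₂_le _ hcov).trans ((encard_insert_le _ _).trans ?_)
  gcongr
  exact encard_heavy_le hμ hε

/-- One of the two labels at the root has mass at least `ε / 2`. A different label below its edge
would disagree with it by at least `ε / 2 > ε / 3`, so both labels at that child coincide with it,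
and the child is not split. -/
theorem epsDim_le_one {ε : ℝ} (hε : 0 < ε) : epsDim ε hyperplaneClass subsphereClass ≤ 1 := by
  refine iSup₂_le fun d ⟨𝒯, h1, h2⟩ => ?_
  by_contra! hd
  have hd : 2 ≤ d := by exact_mod_cast Order.add_one_le_of_lt hd
  have h0 : ([] : List Bool).length < d := by simp; omega
  have hpos : 0 < ENNReal.ofReal ε := ENNReal.ofReal_pos.2 hε
  obtain ⟨b, hb⟩ : ∃ b, ENNReal.ofReal (ε / 2) ≤
      (𝒯.dist [] : Measure SphereUnion) {x | 𝒯.label [] b x = true} := by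
    by_contra! hlt
    have h3 := (h1 [] h0).trans_lt (disagreement_le_add.trans_lt
      (ENNReal.add_lt_add (hlt false) (hlt true)))
    rw [← ENNReal.ofReal_add (by positivity) (by positivity), add_halves] at h3
    exact lt_irrefl _ h3
  have hb1 : ([b] : List Bool).length < d := by simp; omega
  have heq : ∀ c, 𝒯.label [b] c = 𝒯.label [] b := by
    intro c
    by_contra hne
    have h3 := measure_le_disagreement (𝒯.dist_mem [] h0) (𝒯.label_mem [b] hb1 c)
      (𝒯.label_mem [] h0 b) hne
    have h4 := (hb.trans h3).trans (h2 [b] hb1 c [] b (by simp))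
    rw [ENNReal.ofReal_le_ofReal_iff (by positivity)] at h4
    linarith
  have h5 := h1 [b] hb1
  rw [heq, heq, disagreement_self] at h5
  exact absurd h5 (not_le.2 hpos)

theorem iSup_coveringNumber_lt_top {ε : ℝ} (hε : 0 < ε) :
    (⨆ μ ∈ mixtures subsphereClass, coveringNumber μ ε hyperplaneClass) < ⊤ := by
  refine lt_of_le_of_lt (iSup₂_le fun μ hμ => coveringNumber_le hμ hε)
    (b := (⌊1 / ε⌋₊ : ℕ∞) + 1) ?_
  exact_mod_cast ENat.natCast_lt_top (⌊1 / ε⌋₊ + 1)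

end Capacity

/-! ### The lower bound for the regret -/

section LowerBound

/-- Flipping the bit `t` is an involution of the labelings which keeps the prediction and exchanges
right and wrong. -/
theorem sum_ite_ne_mul_two {T : ℕ} (t : Fin T) (P : (Fin T → Bool) → Bool)
    (hP : ∀ b x, P (Function.update b t x) = P b) :
    (∑ b : Fin T → Bool, if P b ≠ b t then (1 : ℝ≥0∞) else 0) * 2 = 2 ^ T := by
  have hinv : Function.Involutive fun b : Fin T → Bool => Function.update b t (!b t) := by
    intro b
    simp
  have h1 := Equiv.sum_comp hinv.toPerm fun b => if P b ≠ b t then (1 : ℝ≥0∞) else 0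
  rw [mul_two]
  conv_lhs => enter [1]; rw [← h1]
  rw [← Finset.sum_add_distrib]
  have h2 : ∀ b : Fin T → Bool, ((if P (hinv.toPerm _ b) ≠ (hinv.toPerm _ b) t then (1 : ℝ≥0∞) else 0) +
      if P b ≠ b t then (1 : ℝ≥0∞) else 0) = 1 := by
    intro b
    simp only [Function.Involutive.coe_toPerm, hP, Function.update_self]
    cases P b <;> cases b t <;> simp
  rw [Finset.sum_congr rfl fun b _ => h2 b]
  simp

variable {Ω X : Type*} [MeasurableSpace Ω] [MeasurableSpace X] {T : ℕ}

/-- The number of mistakes of a learner, as a function of its seed and of the instances, when the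
labels are `b`. -/
def mistakes (L : Learner Ω X T) (b : Fin T → Bool) (p : Ω × (Fin T → X)) : ℝ≥0∞ :=
  ∑ t : Fin T, if L.predict t (p.1, fun s => p.2 (s.castLE t.is_lt.le),
    fun s => b (s.castLE t.is_lt.le), p.2 t) ≠ b t then 1 else 0

theorem measurable_mistakes (L : Learner Ω X T) (b : Fin T → Bool) : Measurable (mistakes L b) := by
  refine Finset.measurable_sum _ fun t _ => Measurable.ite ?_ measurable_const measurable_const
  have h : Measurable fun p : Ω × (Fin T → X) => L.predict t (p.1,
      fun s => p.2 (s.castLE t.is_lt.le), fun s => b (s.castLE t.is_lt.le), p.2 t) :=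
    (L.measurable_predict t).comp (by fun_prop)
  exact (h (measurableSet_singleton (b t))).compl

theorem mistakes_le (L : Learner Ω X T) (b : Fin T → Bool) (p : Ω × (Fin T → X)) :
    mistakes L b p ≤ T := by
  refine (Finset.sum_le_sum (g := fun _ => 1) fun t _ => ?_).trans (by simp)
  split_ifs <;> simp

/-- For a fixed seed and fixed instances, the prediction in round `t` depends only on the labels
before `t`, so on average over `b` half of the rounds are mistakes. -/
theorem sum_mistakes_mul_two (L : Learner Ω X T) (p : Ω × (Fin T → X)) :
    (∑ b, mistakes L b p) * 2 = T * 2 ^ T := by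
  unfold mistakes
  rw [Finset.sum_comm, Finset.sum_mul]
  rw [Finset.sum_congr rfl fun t _ => sum_ite_ne_mul_two t (fun b => L.predict t (p.1,
    fun s => p.2 (s.castLE t.is_lt.le), fun s => b (s.castLE t.is_lt.le), p.2 t)) fun b x => ?_]
  · simp
  · congr 4
    ext s
    rw [Function.update_of_ne]
    exact (Fin.ne_of_lt s.is_lt)

/-- The adversary with deterministic labels `b`. -/
def labelAdversary {U : Set (ProbabilityMeasure X)} (μ : Fin T → ProbabilityMeasure X)
    (hμ : ∀ t, μ t ∈ U) (b : Fin T → Bool) : ObliviousAdversary U T where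
  dist := μ
  dist_mem := hμ
  value t _ := b t
  measurable_value _ := measurable_const

theorem ofReal_learnerLoss_labelAdversary {U : Set (ProbabilityMeasure X)}
    {μ : Fin T → ProbabilityMeasure X} {hμ : ∀ t, μ t ∈ U} {b : Fin T → Bool}
    (ρ : Measure Ω) [IsProbabilityMeasure ρ] (L : Learner Ω X T) :
    ENNReal.ofReal (learnerLoss ρ L (labelAdversary μ hμ b)) =
      ∫⁻ x, ∫⁻ ω, mistakes L b (ω, x) ∂ρ ∂(Measure.pi fun t => (μ t : Measure X)) := by
  rw [← lintegral_prod_symm (mistakes L b) (measurable_mistakes L b).aemeasurable]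
  have h1 : ∀ p, ∑ t : Fin T, (if L.prediction (labelAdversary μ hμ b) p.1 p.2 t ≠
      (labelAdversary μ hμ b).value t (p.2 t) then (1 : ℝ) else 0) = (mistakes L b p).toReal := by
    intro p
    rw [mistakes, ENNReal.toReal_sum fun t _ => by split_ifs <;> simp]
    refine Finset.sum_congr rfl fun t _ => ?_
    simp only [Learner.prediction, labelAdversary]
    split_ifs with h <;> simp [h]
  have htop : ∀ p, mistakes L b p ≠ ⊤ := fun p =>
    ne_top_of_le_ne_top (ENNReal.natCast_ne_top T) (mistakes_le L b p)
  unfold learnerLoss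
  simp_rw [h1]
  rw [integral_toReal (measurable_mistakes L b).aemeasurable
    (Eventually.of_forall fun p => lt_top_iff_ne_top.2 (htop p)), ENNReal.ofReal_toReal]
  · rfl
  · have : IsProbabilityMeasure (labelAdversary μ hμ b).law := by
      unfold ObliviousAdversary.law
      infer_instance
    refine ne_top_of_le_ne_top (ENNReal.natCast_ne_top T)
      ((lintegral_mono (mistakes_le L b)).trans ?_)
    simp

theorem functionLoss_nonneg {U : Set (ProbabilityMeasure X)} (f : X → Bool)
    (A : ObliviousAdversary U T) : 0 ≤ functionLoss f A :=
  integral_nonneg fun x => Finset.sum_nonneg fun t _ => by split_ifs <;> simp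

/-- The realizing function has loss 0, so the infimum subtracted in the regret is not positive. -/
theorem learnerLoss_le_obliviousRegret {U : Set (ProbabilityMeasure X)} {F : Set (X → Bool)}
    {A : ObliviousAdversary U T} (hA : A.IsRealizable F) (ρ : Measure Ω) (L : Learner Ω X T) :
    learnerLoss ρ L A ≤ obliviousRegret F ρ L A := by
  obtain ⟨f, hf, h⟩ := hA
  have h0 : functionLoss f A = 0 := by
    unfold functionLoss
    rw [integral_eq_zero_of_ae]
    filter_upwards [h] with x hx
    simp [hx]
  have h1 : ⨅ f : F, functionLoss (f : X → Bool) A ≤ 0 := by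
    rw [← h0]
    exact ciInf_le (f := fun f : F => functionLoss (f : X → Bool) A)
      ⟨0, by rintro _ ⟨g, rfl⟩; exact functionLoss_nonneg _ _⟩ ⟨f, hf⟩
  unfold obliviousRegret
  linarith

theorem reject_direction {F : Type*} [NormedAddCommGroup F] [InnerProductSpace ℝ F] [Nontrivial F]
    {v : F} (hv : v ≠ 0) (g : F) : reject (direction v : F) g = reject v g := by
  rw [coe_direction hv, reject_smul_left (inv_ne_zero (norm_ne_zero_iff.2 hv))]

/-- Two independent Gaussian vectors are almost surely linearly independent. -/
theorem ae_reject_ne_zero {E : Type*} [NormedAddCommGroup E] [InnerProductSpace ℝ E]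
    [FiniteDimensional ℝ E] [MeasurableSpace E] [BorelSpace E] (hE : 2 ≤ Module.finrank ℝ E) :
    ∀ᵐ p : E × E ∂((gauss E).prod (gauss E)), p.1 ≠ 0 ∧ p.2 ≠ 0 ∧ reject p.2 p.1 ≠ 0 := by
  have : Nontrivial E := Module.nontrivial_of_finrank_pos (R := ℝ) (by omega)
  have hm : MeasurableSet {p : E × E | p.1 ≠ 0 ∧ p.2 ≠ 0 ∧ reject p.2 p.1 ≠ 0} :=
    ((measurable_fst (measurableSet_singleton (0 : E))).compl).inter
      (((measurable_snd (measurableSet_singleton (0 : E))).compl).inter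
        (((by fun_prop : Measurable fun p : E × E => reject p.2 p.1)
          (measurableSet_singleton (0 : E))).compl))
  refine (Measure.ae_prod_iff_ae_ae hm).2 ?_
  filter_upwards [gauss_absolutelyContinuous.ae_le (ae_ne_zero (E := E))] with v hv
  have : Nontrivial (ℝ ∙ v)ᗮ := by
    refine Module.nontrivial_of_finrank_pos (R := ℝ) ?_
    have h1 := (ℝ ∙ v).finrank_add_finrank_orthogonal
    rw [finrank_span_singleton hv] at h1
    omega
  obtain ⟨u, hu⟩ := exists_ne (0 : (ℝ ∙ v)ᗮ)
  have hu0 : (u : E) ≠ 0 := by simpa using hu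
  filter_upwards [gauss_absolutelyContinuous.ae_le (ae_ne_zero (E := E)),
    gauss_absolutelyContinuous.ae_le (ae_inner_ne_zero hu0)] with w hw huw
  refine ⟨hv, hw, fun h => ?_⟩
  have h1 : inner ℝ (u : E) v = 0 := by
    rw [real_inner_comm]
    exact Submodule.mem_orthogonal_singleton_iff_inner_right.1 u.2
  rw [reject, sub_eq_zero] at h
  replace h1 := (congrArg (inner ℝ (u : E)) h).symm.trans h1
  rw [inner_smul_right] at h1
  rcases mul_eq_zero.1 h1 with h2 | h2
  · rw [h2, zero_smul] at h
    exact hv h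
  · exact huw h2

theorem exists_realizable_obliviousRegret_ge (hT : 1 ≤ T) (ρ : Measure Ω) [IsProbabilityMeasure ρ]
    (L : Learner Ω SphereUnion T) :
    ∃ A : ObliviousAdversary subsphereClass T, A.IsRealizable hyperplaneClass ∧
      (T : ℝ) / 4 ≤ obliviousRegret hyperplaneClass ρ L A := by
  obtain ⟨d, hd⟩ : ∃ d : ℕ, d = 8 * T ^ 2 + 2 * T := ⟨_, rfl⟩
  have hd2 : 2 ≤ d := by omega
  have := nontrivial_euclideanSpace hd2
  set E := EuclideanSpace ℝ (Fin d) with hE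
  have hfin : Module.finrank ℝ E = d := finrank_euclideanSpace_fin
  obtain ⟨Q, _, hQ⟩ := exists_le_lintegral_reject (E := E) hT (hfin.trans hd)
  set Ψ : (Fin T → Bool) → (Fin T → E) → ℝ≥0∞ := fun b x =>
    ∫⁻ ω, mistakes L b (ω, fun t => sphereDirection (x t)) ∂ρ with hΨ
  have hdir : Measurable fun (x : Fin T → E) (t : Fin T) => sphereDirection (x t) :=
    measurable_pi_iff.2 fun t => measurable_sphereDirection.comp (measurable_pi_apply t)
  have hΨm' : ∀ b, Measurable fun x : Fin T → SphereUnion => ∫⁻ ω, mistakes L b (ω, x) ∂ρ :=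
    fun b => (measurable_mistakes L b).lintegral_prod_left'
  have hΨm : ∀ b, Measurable (Ψ b) := fun b => (hΨm' b).comp hdir
  have hΨle : ∀ b x, Ψ b x ≤ T := fun b x =>
    (lintegral_mono fun ω => mistakes_le L b _).trans (by simp)
  have hΨsum : ∀ x, (∑ b, Ψ b x) * 2 = T * 2 ^ T := by
    intro x
    have hm : ∀ b, Measurable fun ω => mistakes L b (ω, fun t => sphereDirection (x t)) := fun b =>
      (measurable_mistakes L b).comp measurable_prodMk_right
    rw [hΨ, ← lintegral_finsetSum _ fun b _ => hm b, ← lintegral_mul_const _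
      (Finset.measurable_sum _ fun b _ => hm b)]
    simp_rw [sum_mistakes_mul_two]
    simp
  -- The expected loss against the adversary with bits `b` and the two hyperplanes orthogonal to
  -- `p.1` and `p.2`; this identification is `hloss` below.
  set f : (Fin T → Bool) → E × E → ℝ≥0∞ := fun b p =>
    ∫⁻ g, Ψ b (fun t => reject (if b t then p.1 else p.2) (g t))
      ∂(Measure.pi fun _ => gauss E) with hf
  have hfm : ∀ b, Measurable (f b) := by
    intro b
    refine Measurable.lintegral_prod_right' (f := fun q : (E × E) × (Fin T → E) =>
      Ψ b (fun t => reject (if b t then q.1.1 else q.1.2) (q.2 t))) ?_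
    refine (hΨm b).comp (measurable_pi_iff.2 fun t => ?_)
    by_cases hb : b t <;> simp only [hb, if_true, Bool.false_eq_true, if_false] <;> fun_prop
  have hfle : ∀ p, ∑ b, f b p ≤ 2 ^ T * T := by
    intro p
    refine (Finset.sum_le_sum (g := fun _ => (T : ℝ≥0∞)) fun b _ => ?_).trans (by simp)
    exact (lintegral_mono fun g => hΨle b _).trans (by simp)
  set c : ℝ≥0∞ := ENNReal.ofReal (3 / 4) with hc
  -- Under the common law `Q ^ T` the losses sum to `2 ^ T * (T / 2)`, and the two factors `3/4`
  -- leave `9 T / 32 ≥ T / 4` per labeling.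
  have hlow : 2 ^ T * ((T : ℝ≥0∞) / 4) ≤ ∫⁻ p, ∑ b, f b p ∂((gauss E).prod (gauss E)) := by
    rw [lintegral_finsetSum _ fun b _ => hfm b]
    refine le_trans ?_ (Finset.sum_le_sum fun b _ => le_lintegral_reject_select hQ b (hΨm b))
    rw [← Finset.mul_sum, ← Finset.mul_sum, ← lintegral_finsetSum _ fun b _ => hΨm b]
    have h1 : ∀ x, ∑ b, Ψ b x = 2 ^ T * (T / 2) := by
      intro x
      rw [← mul_div_assoc, ENNReal.eq_div_iff (by simp) (by simp), mul_comm, hΨsum, mul_comm]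
    simp_rw [h1]
    rw [lintegral_const, measure_univ, mul_one]
    have h2 : (T : ℝ≥0∞) = ENNReal.ofReal T := (ENNReal.ofReal_natCast T).symm
    have h3 : (2 : ℝ≥0∞) = ENNReal.ofReal 2 := by simp
    have h4 : (4 : ℝ≥0∞) = ENNReal.ofReal 4 := by simp
    rw [h2, h3, h4, hc, ← ENNReal.ofReal_div_of_pos (by norm_num),
      ← ENNReal.ofReal_div_of_pos (by norm_num), ← ENNReal.ofReal_pow (by norm_num),
      ← ENNReal.ofReal_mul (by positivity), ← ENNReal.ofReal_mul (by positivity),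
      ← ENNReal.ofReal_mul (by positivity), ← ENNReal.ofReal_mul (by positivity)]
    refine ENNReal.ofReal_le_ofReal ?_
    have : (0 : ℝ) ≤ 2 ^ T * T := by positivity
    nlinarith
  -- A pair at least as bad as the average, chosen outside the null set of linearly dependent pairs;
  -- the labeling `b` is then found by averaging the finite sum.
  obtain ⟨p, hp, hpf⟩ := exists_notMem_null_lintegral_le
    (μ := (gauss E).prod (gauss E)) (f := fun p => ∑ b, f b p)
    (ne_top_of_le_ne_top (b := 2 ^ T * (T : ℝ≥0∞))
      (ENNReal.mul_ne_top (by simp) (ENNReal.natCast_ne_top T))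
      ((lintegral_mono hfle).trans (by simp)))
    (ae_iff.1 (ae_reject_ne_zero (E := E) (by omega)))
  simp only [mem_ofPred_eq, not_not] at hp
  obtain ⟨hv, hw, hvw⟩ := hp
  obtain ⟨b, -, hb⟩ := ENNReal.exists_le_of_sum_le (s := Finset.univ) Finset.univ_nonempty
    (f := fun _ : Fin T → Bool => (T : ℝ≥0∞) / 4) (g := fun b => f b p)
    (by simpa using hlow.trans hpf)
  set u : Fin T → USphere d := fun t => direction (if b t then p.1 else p.2) with hu
  have hne : ∀ t, (if b t then p.1 else p.2) ≠ 0 := fun t => by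
    split_ifs
    exacts [hv, hw]
  have hmem : ∀ t, subsphereUniform hd2 (u t) ∈ subsphereClass := fun t => ⟨d, hd2, u t, rfl⟩
  set A : ObliviousAdversary subsphereClass T :=
    labelAdversary (fun t => subsphereUniform hd2 (u t)) hmem b with hA
  -- The indicator of `H_{p.1}` is 1 almost surely in the rounds with label 1. In the others it is 0
  -- almost surely, because `p.1` and `p.2` are independent directions.
  have hreal : A.IsRealizable hyperplaneClass := by
    refine ⟨hyperplaneIndicator (direction p.1), ⟨d, _, rfl⟩, ae_all_iff.2 fun t => ?_⟩
    have h1 : ∀ᵐ y ∂((subsphereUniform hd2 (u t) : ProbabilityMeasure SphereUnion) :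
        Measure SphereUnion), hyperplaneIndicator (direction p.1) y = b t := by
      change ∀ᵐ y ∂subsphereMeasure (u t), hyperplaneIndicator (direction p.1) y = b t
      by_cases hbt : b t = true
      · have h2 : u t = direction p.1 := by simp [hu, hbt]
        rw [h2, hbt]
        have h3 := subsphereMeasure_compl (direction p.1 : USphere d)
        rwa [← hyperplaneIndicator_preimage] at h3
      · have h2 : u t = direction p.2 := by simp [hu, hbt]
        rw [h2, Bool.eq_false_iff.2 hbt]
        have h3 : subsphereMeasure (direction p.2 : USphere d)
            (greatSubsphere (direction p.1 : USphere d)) = 0 := by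
          refine subsphereMeasure_greatSubsphere_of_reject hd2 ?_
          rw [reject_direction hw, coe_direction hv, reject_smul]
          exact smul_ne_zero (inv_ne_zero (norm_ne_zero_iff.2 hv)) hvw
        rw [← hyperplaneIndicator_preimage] at h3
        rw [ae_iff]
        simpa using h3
    exact (measurePreserving_eval (fun t => ((subsphereUniform hd2 (u t) :
      ProbabilityMeasure SphereUnion) : Measure SphereUnion)) t).quasiMeasurePreserving.ae h1
  refine ⟨A, hreal, le_trans ?_ (learnerLoss_le_obliviousRegret hreal ρ L)⟩
  -- Rescaling `p.1` and `p.2` to unit vectors does not change the projections, so Gaussian tuples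
  -- produce exactly the instances of the adversary.
  have hlaw : MeasurePreserving
      (fun (g : Fin T → E) t => sphereDirection (reject (if b t then p.1 else p.2) (g t)))
      (Measure.pi fun _ => gauss E) (Measure.pi fun t => subsphereMeasure (u t)) := by
    have h1 : ∀ t, MeasurePreserving
        (fun g : E => sphereDirection (reject (if b t then p.1 else p.2) g))
        (gauss E) (subsphereMeasure (u t)) := by
      intro t
      refine ⟨measurable_sphereDirection_reject _, ?_⟩
      rw [subsphereMeasure_eq_map hd2]
      simp_rw [hu, reject_direction (hne t)]
      rfl
    have : ∀ t, IsProbabilityMeasure (subsphereMeasure (u t)) := fun t =>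
      isProbabilityMeasure_subsphereMeasure hd2 (u t)
    exact measurePreserving_pi _ _ h1
  have hloss : ENNReal.ofReal (learnerLoss ρ L A) = f b p := by
    rw [hA, ofReal_learnerLoss_labelAdversary]
    exact (hlaw.lintegral_comp (hΨm' b)).symm
  rw [← hloss] at hb
  have h4 : (T : ℝ≥0∞) / 4 = ENNReal.ofReal ((T : ℝ) / 4) := by
    rw [ENNReal.ofReal_div_of_pos (by norm_num), ENNReal.ofReal_natCast]
    simp
  rw [h4] at hb
  have hpos : 0 < (T : ℝ) / 4 := by positivity
  exact (ENNReal.ofReal_le_ofReal_iff'.1 hb).resolve_right (not_le.2 hpos)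

theorem le_minimaxRegretRealizable (hT : 1 ≤ T) (ρ : Measure Ω) [IsProbabilityMeasure ρ] :
    (((T : ℝ) / 4 : ℝ) : EReal) ≤ minimaxRegretRealizable ρ hyperplaneClass subsphereClass T := by
  refine le_iInf fun L => ?_
  obtain ⟨A, hA, h⟩ := exists_realizable_obliviousRegret_ge hT ρ L
  exact (EReal.coe_le_coe_iff.2 h).trans (le_iSup₂ (f := fun (A : ObliviousAdversary subsphereClass T)
    (_ : A.IsRealizable hyperplaneClass) => (obliviousRegret hyperplaneClass ρ L A : EReal)) A hA)

theorem minimaxRegretRealizable_le (ρ : Measure Ω) (F : Set (X → Bool))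
    (U : Set (ProbabilityMeasure X)) (T : ℕ) :
    minimaxRegretRealizable ρ F U T ≤ minimaxRegret ρ F U T :=
  iInf_mono fun _ => iSup_mono fun _ => iSup_le fun _ => le_rfl

theorem not_tendsto_div_of_le {R : ℕ → EReal}
    (h : ∀ T : ℕ, 1 ≤ T → (((T : ℝ) / 4 : ℝ) : EReal) ≤ R T) :
    ¬ Tendsto (fun T : ℕ => R T / ((T : ℝ) : EReal)) atTop (𝓝 0) := by
  intro ht
  have h1 : ((1 / 4 : ℝ) : EReal) ≤ 0 := by
    refine ge_of_tendsto ht ?_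
    filter_upwards [eventually_ge_atTop 1] with T hT
    have hT0 : (0 : ℝ) < T := by exact_mod_cast hT
    have h2 : (((T : ℝ) / 4 : ℝ) : EReal) / ((T : ℝ) : EReal) = ((1 / 4 : ℝ) : EReal) := by
      rw [← EReal.coe_div]
      congr 1
      field_simp
    rw [← h2]
    exact EReal.div_le_div_right_of_nonneg (by exact_mod_cast hT0.le) (h T hT)
  have h3 : (1 / 4 : ℝ) ≤ 0 := by exact_mod_cast h1
  norm_num at h3

end LowerBound

end ConstrainedOnline

end

theorem mainTheorem5 :
    (∀ f ∈ hyperplaneClass, Measurable f) ∧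
    (∀ ε : ℝ, 0 < ε →
      (⨆ μ ∈ mixtures subsphereClass, coveringNumber μ ε hyperplaneClass) < ⊤ ∧
      epsDim ε hyperplaneClass subsphereClass < ⊤) ∧
    (∀ (Ω : Type*) [MeasurableSpace Ω] (ρ : Measure Ω) [IsProbabilityMeasure ρ],
      (∀ T : ℕ, 1 ≤ T →
        (((T : ℝ) / 4 : ℝ) : EReal)
            ≤ minimaxRegretRealizable ρ hyperplaneClass subsphereClass T ∧
        minimaxRegretRealizable ρ hyperplaneClass subsphereClass T
            ≤ minimaxRegret ρ hyperplaneClass subsphereClass T) ∧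
      ¬ ObliviouslyLearnableRealizable ρ hyperplaneClass subsphereClass ∧
      ¬ ObliviouslyLearnable ρ hyperplaneClass subsphereClass) := by
  refine ⟨fun f hf => measurable_of_mem_hyperplaneClass hf, fun ε hε =>
    ⟨iSup_coveringNumber_lt_top hε, (epsDim_le_one hε).trans_lt (by simp)⟩, ?_⟩
  intro Ω _ ρ _
  refine ⟨fun T hT => ⟨le_minimaxRegretRealizable hT ρ, minimaxRegretRealizable_le _ _ _ _⟩,
    not_tendsto_div_of_le fun T hT => le_minimaxRegretRealizable hT ρ,
    not_tendsto_div_of_le fun T hT => (le_minimaxRegretRealizable hT ρ).trans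
      (minimaxRegretRealizable_le _ _ _ _)⟩
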